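/- Let $k$ be a field and let $X$ be a well-ordered set. A *Poisson algebra* over $k$ is a $k$-vector space $\mathcal P$ with two bilinear operations, a multiplication $\cdot$ and a bracket $(-,-)$, such that $(\mathcal P,\cdot)$ is an associative commutative (not necessarily unital) algebra, $(\mathcal P,(-,-))$ is a Lie algebra, and $(x,y\cdot z)=(x,y)\cdot z+y\cdot(x,z)$. It is *metabelian* if it has an ideal $I$ such that both operations vanish on $I$ and both operations induced on $\mathcal P/I$ vanish. Let $\mathcal{MP}_k(X)$ be the free metabelian Poisson algebra on $X$. Write $[x_1,\dots,x_n]=(\dots((x_1,x_2),x_3),\dots,x_n)$, with $[x_1]=x_1$, and put $$Y_1=\{[a_1,\dots,a_n] : n\ge 1,\ a_2\le\dots\le a_n,\ a_1>a_2\text{ if } n\ge 2\},$$ $$Y_2=\{a_1\cdots a_t : 2\le t\le 3,\ a_1\le\dots\le a_t\},\qquad Y_3=\{[a_1,a_2]\cdot a_3 : a_1>a_2\},$$ $$Y_4=\{[a_1,a_2,a_3]\cdot a_4 : a_2<a_1\le a_4,\ a_2\le a_3<a_4\},$$ $$Y_5=\{[a_1,\dots,a_n]\cdot a_{n+1} :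 n\ge 3,\ a_1>a_2,\ a_2\le\dots\le a_{n+1}\},$$ with all $a_i\in X$, as sets of formal words. Let $\mathrm{MPB}_k(X)=Y_1\cup Y_2\cup Y_3\cup Y_4$ if $\operatorname{char}(k)\ne 2$ and $\mathrm{MPB}_k(X)=Y_1\cup Y_2\cup Y_3\cup Y_5$ if $\operatorname{char}(k)=2$. Let $k\mathrm{MPB}_k(X)$ be the vector space with basis $\mathrm{MPB}_k(X)$. For letters $c_1,\dots,c_m$ ($m\ge1$) with nondecreasing reordering $d_1\le\dots\le d_m$ write $\overrightarrow{c_1,\dots,c_m}=d_1,\dots,d_m$ and $\langle a_1,a_2\,|\,c_1,\dots,c_m\rangle=[a_1,a_2,d_1,\dots,d_{m-1}]\cdot d_m$. Define bilinear operations $\circ$ and $\{-,-\}$ on $k\mathrm{MPB}_k(X)$ by the following rules, where $a,b,c,a_i\in X$, the words on the left lie in $\mathrm{MPB}_k(X)$, and $(\sum_i\alpha_iu_i)\cdot c$ means $\sum_i\alpha_i(u_i\cdot c)$ for brackets $u_i$. 1. If $W_1,W_2\in\mathrm{MPB}_k(X)\setminus X$, then $W_1\circ W_2=\{W_1,W_2\}=0$.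 If $W\in\mathrm{MPB}_k(X)\setminus X$, then $a\circ W=W\circ a$ and $\{a,W\}=-\{W,a\}$. 2. $b\circ a$ is the word $b\cdot a$ or $a\cdot b$ with its letters in nondecreasing order; $\{b,a\}$ is $[b,a]$ if $b>a$, is $0$ if $b=a$, and is $-[a,b]$ if $b<a$. 3. $(a_1\cdot a_2)\circ a$ is the product of $a_1,a_2,a$ in nondecreasing order; $\{a_1\cdot a_2,a\}=\{a_1,a\}\cdot a_2+\{a_2,a\}\cdot a_1$; $(a_1\cdot a_2\cdot a_3)\circ a=\{a_1\cdot a_2\cdot a_3,a\}=0$. 4. For $n\ge 2$, $\{[a_1,\dots,a_n],a\}$ is $[a_1,a_2,\overrightarrow{a_3,\dots,a_n,a}]$ if $a\ge a_2$, and is $[a_1,a,a_2,\dots,a_n]-[a_2,a,\overrightarrow{a_1,a_3,\dots,a_n}]$ if $a<a_2$. 5. $[a_1,a_2]\circ a=[a_1,a_2]\cdot a$. 6. If $\operatorname{char}(k)\ne2$, then $[a_1,\dots,a_n]\circ a=0$ for $n\ge4$, and $[a_1,a_2,a_3]\circ a$ is $0$ if $a_3=a$; $[a_1,a_2,a_3]\cdot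 a$ if $a>a_3$ and $a\ge a_1$; $\{\{a,a_3\},a_2\}\cdot a_1$ if $a_3<a<a_1$ or $a<a_3<a_1$; $-\{\{a_1,a_2\},a\}\cdot a_3$ if $a_3>a$ and $a_3>a_1$; $-[a_3,a_2,a]\cdot a_1$ if $a_3=a_1>a\ge a_2$; $-[a_3,a,a_2]\cdot a_1$ if $a_3=a_1>a_2>a$. 7. If $\operatorname{char}(k)=2$ and $n\ge3$, then $[a_1,\dots,a_n]\circ a$ is $\langle a_1,a_2\,|\,a,a_3,\dots,a_n\rangle$ if $a\ge a_2$, and is $\langle a_1,a\,|\,a_2,\dots,a_n\rangle-\langle a_2,a\,|\,a_1,a_3,\dots,a_n\rangle$ if $a<a_2$. 8. $([a_1,\dots,a_n]\cdot c)\circ a=0$ for $n\ge2$, and $\{[a_1,a_2]\cdot a_3,a\}=\{[a_1,a_2],a\}\circ a_3$. 9. For $n\ge3$, $\{[a_1,\dots,a_n]\cdot c,a\}$ is $0$ if $\operatorname{char}(k)\ne2$; if $\operatorname{char}(k)=2$, it is $\langle a_1,a_2\,|\,a_3,\dots,a_n,c,a\rangle$ if $a\ge a_2$, and $[a_1,a,a_2,\dots,a_n]\cdot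 c-\langle a_2,a\,|\,a_3,\dots,a_n,c,a_1\rangle$ if $a<a_2$. **Theorem.** $(k\mathrm{MPB}_k(X),\circ,\{-,-\})$ is a metabelian Poisson algebra, and there is an isomorphism of Poisson algebras $\mathcal{MP}_k(X)\to k\mathrm{MPB}_k(X)$ that sends the value in $\mathcal{MP}_k(X)$ of each word $W\in\mathrm{MPB}_k(X)$ to the basis element $W$ (in particular $a\mapsto a$ for $a\in X$). In particular, the values of the words of $\mathrm{MPB}_k(X)$ form a linear basis of $\mathcal{MP}_k(X)$. -/

import Mathlib

noncomputable section

/-! ### Poisson algebras (not necessarily unital) and metabelian Poisson algebras -/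

section Poisson

variable {k A : Type*} [Field k] [AddCommGroup A] [Module k A]

/-- The vector space `A` with the bilinear multiplication `mul` and the bilinear bracket `br` is a
Poisson algebra. -/
structure IsPoissonAlgebra (mul br : A →ₗ[k] A →ₗ[k] A) : Prop where
  mul_comm : ∀ x y, mul x y = mul y x
  mul_assoc : ∀ x y z, mul (mul x y) z = mul x (mul y z)
  br_self : ∀ x, br x x = 0
  jacobi : ∀ x y z, br (br x y) z + br (br y z) x + br (br z x) y = 0
  leibniz : ∀ x y z, br x (mul y z) = mul (br x y) z + mul y (br x z)

/-- A subspace that is an ideal for both operations of a Poisson algebra. -/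
structure IsPoissonIdeal (mul br : A →ₗ[k] A →ₗ[k] A) (I : Submodule k A) : Prop where
  mul_mem : ∀ x, ∀ y ∈ I, mul x y ∈ I
  br_mem : ∀ x, ∀ y ∈ I, br x y ∈ I

/-- A Poisson algebra is metabelian if it is an extension of an abelian Poisson algebra by an
abelian one: it has an ideal `I` with trivial operations such that the operations of the quotient
by `I` are trivial. -/
def IsMetabelian (mul br : A →ₗ[k] A →ₗ[k] A) : Prop :=
  ∃ I : Submodule k A, IsPoissonIdeal mul br I ∧
    (∀ x ∈ I, ∀ y ∈ I, mul x y = 0 ∧ br x y = 0) ∧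
    (∀ x y, mul x y ∈ I ∧ br x y ∈ I)

/-- The left-normed bracket `[x, y₁, …, yₙ] = (…((x, y₁), y₂), …, yₙ)`. -/
def leftNormed (br : A →ₗ[k] A →ₗ[k] A) (x : A) (l : List A) : A :=
  l.foldl (fun u v => br u v) x

end Poisson

/-! ### The free metabelian Poisson algebra -/

/-- Nonassociative words in the letters `X` with two binary operations. -/
inductive PWord (X : Type*) where
  | of (a : X) : PWord X
  | mul (u v : PWord X) : PWord X
  | br (u v : PWord X) : PWord X

section Free

variable (k : Type*) (X : Type*) [Field k]

/-- The free algebra on `X` with two bilinear operations. -/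
abbrev FreeTwoOp := PWord X →₀ k

/-- The first operation of `FreeTwoOp k X`. -/
def FreeTwoOp.mul : FreeTwoOp k X →ₗ[k] FreeTwoOp k X →ₗ[k] FreeTwoOp k X :=
  Finsupp.linearCombination k fun u => Finsupp.linearCombination k fun v =>
    Finsupp.single (PWord.mul u v) 1

/-- The second operation of `FreeTwoOp k X`. -/
def FreeTwoOp.br : FreeTwoOp k X →ₗ[k] FreeTwoOp k X →ₗ[k] FreeTwoOp k X :=
  Finsupp.linearCombination k fun u => Finsupp.linearCombination k fun v =>
    Finsupp.single (PWord.br u v) 1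

open FreeTwoOp in
/-- `J` is a two-sided ideal for both operations, and the quotient by `J` satisfies the identities
of metabelian Poisson algebras. -/
structure IsMetabelianPoissonIdeal (J : Submodule k (FreeTwoOp k X)) : Prop where
  mul_left_mem : ∀ x, ∀ y ∈ J, mul k X x y ∈ J
  mul_right_mem : ∀ x ∈ J, ∀ y, mul k X x y ∈ J
  br_left_mem : ∀ x, ∀ y ∈ J, br k X x y ∈ J
  br_right_mem : ∀ x ∈ J, ∀ y, br k X x y ∈ J
  mul_comm : ∀ x y, mul k X x y - mul k X y x ∈ J
  mul_assoc : ∀ x y z, mul k X (mul k X x y) z - mul k X x (mul k X y z) ∈ J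
  br_self : ∀ x, br k X x x ∈ J
  jacobi : ∀ x y z, br k X (br k X x y) z + br k X (br k X y z) x + br k X (br k X z x) y ∈ J
  leibniz : ∀ x y z,
    br k X x (mul k X y z) - (mul k X (br k X x y) z + mul k X y (br k X x z)) ∈ J
  metabelian : ∀ f ∈ ({mul k X, br k X} : Set _), ∀ g ∈ ({mul k X, br k X} : Set _),
    ∀ h ∈ ({mul k X, br k X} : Set _), ∀ x y z w, h (f x y) (g z w) ∈ J

/-- The ideal of all consequences of the identities of metabelian Poisson algebras. -/
def metabelianPoissonIdeal : Submodule k (FreeTwoOp k X) :=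
  sInf {J | IsMetabelianPoissonIdeal k X J}

theorem isMetabelianPoissonIdeal_metabelianPoissonIdeal :
    IsMetabelianPoissonIdeal k X (metabelianPoissonIdeal k X) where
  mul_left_mem x y hy := (Submodule.mem_sInf).2 fun J hJ =>
    hJ.mul_left_mem x y ((Submodule.mem_sInf).1 hy J hJ)
  mul_right_mem x hx y := (Submodule.mem_sInf).2 fun J hJ =>
    hJ.mul_right_mem x ((Submodule.mem_sInf).1 hx J hJ) y
  br_left_mem x y hy := (Submodule.mem_sInf).2 fun J hJ =>
    hJ.br_left_mem x y ((Submodule.mem_sInf).1 hy J hJ)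
  br_right_mem x hx y := (Submodule.mem_sInf).2 fun J hJ =>
    hJ.br_right_mem x ((Submodule.mem_sInf).1 hx J hJ) y
  mul_comm x y := (Submodule.mem_sInf).2 fun _ hJ => hJ.mul_comm x y
  mul_assoc x y z := (Submodule.mem_sInf).2 fun _ hJ => hJ.mul_assoc x y z
  br_self x := (Submodule.mem_sInf).2 fun _ hJ => hJ.br_self x
  jacobi x y z := (Submodule.mem_sInf).2 fun _ hJ => hJ.jacobi x y z
  leibniz x y z := (Submodule.mem_sInf).2 fun _ hJ => hJ.leibniz x y z
  metabelian f hf g hg h hh x y z w := (Submodule.mem_sInf).2 fun _ hJ =>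
    hJ.metabelian f hf g hg h hh x y z w

/-- The free metabelian Poisson algebra `MP_k(X)`. -/
def MP := FreeTwoOp k X ⧸ metabelianPoissonIdeal k X

instance : AddCommGroup (MP k X) :=
  inferInstanceAs (AddCommGroup (FreeTwoOp k X ⧸ metabelianPoissonIdeal k X))

instance : Module k (MP k X) :=
  inferInstanceAs (Module k (FreeTwoOp k X ⧸ metabelianPoissonIdeal k X))

/-- A bilinear operation descends to the quotient by a two-sided ideal. -/
def quotBilin {k F : Type*} [Field k] [AddCommGroup F] [Module k F] (I : Submodule k F)
    (f : F →ₗ[k] F →ₗ[k] F) (hl : ∀ x, ∀ y ∈ I, f x y ∈ I) (hr : ∀ x ∈ I, ∀ y, f x y ∈ I) :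
    (F ⧸ I) →ₗ[k] (F ⧸ I) →ₗ[k] (F ⧸ I) :=
  I.liftQ
    { toFun := fun x => I.mapQ I (f x) (fun y hy => hl x y hy)
      map_add' := fun x y => by
        refine Submodule.linearMap_qext _ ?_
        ext z
        simp
      map_smul' := fun c x => by
        refine Submodule.linearMap_qext _ ?_
        ext z
        simp }
    (fun x hx => by
      rw [LinearMap.mem_ker]
      refine Submodule.linearMap_qext _ ?_
      ext z
      simpa using hr x hx z)

/-- The projection of `FreeTwoOp k X` onto `MP k X`. -/
def MP.mk : FreeTwoOp k X →ₗ[k] MP k X := (metabelianPoissonIdeal k X).mkQ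

/-- The multiplication of `MP k X`. -/
def MP.mul : MP k X →ₗ[k] MP k X →ₗ[k] MP k X :=
  quotBilin (metabelianPoissonIdeal k X) (FreeTwoOp.mul k X)
    (isMetabelianPoissonIdeal_metabelianPoissonIdeal k X).mul_left_mem
    (isMetabelianPoissonIdeal_metabelianPoissonIdeal k X).mul_right_mem

/-- The Poisson bracket of `MP k X`. -/
def MP.br : MP k X →ₗ[k] MP k X →ₗ[k] MP k X :=
  quotBilin (metabelianPoissonIdeal k X) (FreeTwoOp.br k X)
    (isMetabelianPoissonIdeal_metabelianPoissonIdeal k X).br_left_mem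
    (isMetabelianPoissonIdeal_metabelianPoissonIdeal k X).br_right_mem

/-- The free generator of `MP k X` given by a letter. -/
def MP.of (a : X) : MP k X := MP.mk k X (Finsupp.single (PWord.of a) 1)

theorem MP.mk_surjective : Function.Surjective (MP.mk k X) := Submodule.mkQ_surjective _

theorem MP.mk_eq_zero {x : FreeTwoOp k X} (hx : x ∈ metabelianPoissonIdeal k X) :
    MP.mk k X x = 0 := (Submodule.Quotient.mk_eq_zero _).2 hx

theorem MP.mul_mk (x y : FreeTwoOp k X) :
    MP.mul k X (MP.mk k X x) (MP.mk k X y) = MP.mk k X (FreeTwoOp.mul k X x y) := rfl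

theorem MP.br_mk (x y : FreeTwoOp k X) :
    MP.br k X (MP.mk k X x) (MP.mk k X y) = MP.mk k X (FreeTwoOp.br k X x y) := rfl

theorem MP.isPoissonAlgebra : IsPoissonAlgebra (MP.mul k X) (MP.br k X) := by
  have H := isMetabelianPoissonIdeal_metabelianPoissonIdeal k X
  have S := MP.mk_surjective k X
  constructor
  · intro x y
    obtain ⟨x, rfl⟩ := S x
    obtain ⟨y, rfl⟩ := S y
    rw [← sub_eq_zero, MP.mul_mk, MP.mul_mk, ← map_sub]
    exact MP.mk_eq_zero k X (H.mul_comm x y)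
  · intro x y z
    obtain ⟨x, rfl⟩ := S x
    obtain ⟨y, rfl⟩ := S y
    obtain ⟨z, rfl⟩ := S z
    rw [← sub_eq_zero]
    simp only [MP.mul_mk, ← map_sub]
    exact MP.mk_eq_zero k X (H.mul_assoc x y z)
  · intro x
    obtain ⟨x, rfl⟩ := S x
    exact MP.mk_eq_zero k X (H.br_self x)
  · intro x y z
    obtain ⟨x, rfl⟩ := S x
    obtain ⟨y, rfl⟩ := S y
    obtain ⟨z, rfl⟩ := S z
    simp only [MP.br_mk, ← map_add]
    exact MP.mk_eq_zero k X (H.jacobi x y z)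
  · intro x y z
    obtain ⟨x, rfl⟩ := S x
    obtain ⟨y, rfl⟩ := S y
    obtain ⟨z, rfl⟩ := S z
    rw [← sub_eq_zero]
    simp only [MP.br_mk, MP.mul_mk, ← map_add, ← map_sub]
    exact MP.mk_eq_zero k X (H.leibniz x y z)

theorem MP.isMetabelian : IsMetabelian (MP.mul k X) (MP.br k X) := by
  have H := isMetabelianPoissonIdeal_metabelianPoissonIdeal k X
  have S := MP.mk_surjective k X
  let T : Set (MP k X) := {w | ∃ x y, w = MP.mul k X x y ∨ w = MP.br k X x y}
  have key : ∀ h ∈ ({MP.mul k X, MP.br k X} : Set _), ∀ u ∈ Submodule.span k T,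
      ∀ v ∈ Submodule.span k T, h u v = 0 := by
    intro h hh u hu v hv
    induction hu using Submodule.span_induction with
    | zero => simp
    | add a b _ _ ha hb => simp [ha, hb]
    | smul c a _ ha => simp [ha]
    | mem u hu =>
      induction hv using Submodule.span_induction with
      | zero => simp
      | add a b _ _ ha hb => simp [ha, hb]
      | smul c a _ ha => simp [ha]
      | mem v hv =>
        obtain ⟨x, y, hu⟩ := hu
        obtain ⟨z, w, hv⟩ := hv
        obtain ⟨x, rfl⟩ := S x
        obtain ⟨y, rfl⟩ := S y
        obtain ⟨z, rfl⟩ := S z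
        obtain ⟨w, rfl⟩ := S w
        have M : FreeTwoOp.mul k X ∈ ({FreeTwoOp.mul k X, FreeTwoOp.br k X} : Set _) := by simp
        have B : FreeTwoOp.br k X ∈ ({FreeTwoOp.mul k X, FreeTwoOp.br k X} : Set _) := by simp
        rcases hh with rfl | rfl <;> rcases hu with rfl | rfl <;> rcases hv with rfl | rfl
        · exact MP.mk_eq_zero k X (H.metabelian _ M _ M _ M x y z w)
        · exact MP.mk_eq_zero k X (H.metabelian _ M _ B _ M x y z w)
        · exact MP.mk_eq_zero k X (H.metabelian _ B _ M _ M x y z w)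
        · exact MP.mk_eq_zero k X (H.metabelian _ B _ B _ M x y z w)
        · exact MP.mk_eq_zero k X (H.metabelian _ M _ M _ B x y z w)
        · exact MP.mk_eq_zero k X (H.metabelian _ M _ B _ B x y z w)
        · exact MP.mk_eq_zero k X (H.metabelian _ B _ M _ B x y z w)
        · exact MP.mk_eq_zero k X (H.metabelian _ B _ B _ B x y z w)
  refine ⟨Submodule.span k T, ⟨?_, ?_⟩, ?_, ?_⟩
  · exact fun x y _ => Submodule.subset_span ⟨x, y, Or.inl rfl⟩
  · exact fun x y _ => Submodule.subset_span ⟨x, y, Or.inr rfl⟩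
  · exact fun x hx y hy => ⟨key _ (by simp) x hx y hy, key _ (by simp) x hx y hy⟩
  · exact fun x y => ⟨Submodule.subset_span ⟨x, y, Or.inl rfl⟩,
      Submodule.subset_span ⟨x, y, Or.inr rfl⟩⟩

/-- The value of a nonassociative word in an algebra with two operations. -/
def PWord.value {k X A : Type*} [Field k] [AddCommGroup A] [Module k A]
    (mul br : A →ₗ[k] A →ₗ[k] A) (f : X → A) : PWord X → A
  | .of a => f a
  | .mul u v => mul (u.value mul br f) (v.value mul br f)
  | .br u v => br (u.value mul br f) (v.value mul br f)

/-- The universal property of `MP k X`. -/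
theorem MP.existsUnique_lift {A : Type*} [AddCommGroup A] [Module k A]
    (mul br : A →ₗ[k] A →ₗ[k] A) (hP : IsPoissonAlgebra mul br) (hM : IsMetabelian mul br)
    (f : X → A) :
    ∃! φ : MP k X →ₗ[k] A, (∀ x y, φ (MP.mul k X x y) = mul (φ x) (φ y)) ∧
      (∀ x y, φ (MP.br k X x y) = br (φ x) (φ y)) ∧ ∀ a, φ (MP.of k X a) = f a := by
  let L : FreeTwoOp k X →ₗ[k] A := Finsupp.linearCombination k (PWord.value mul br f)
  have Lmul : ∀ x y, L (FreeTwoOp.mul k X x y) = mul (L x) (L y) := by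
    have : (FreeTwoOp.mul k X).compr₂ L = mul.compl₁₂ L L := by
      ext u v
      simp [L, FreeTwoOp.mul, PWord.value]
    exact fun x y => LinearMap.congr_fun₂ this x y
  have Lbr : ∀ x y, L (FreeTwoOp.br k X x y) = br (L x) (L y) := by
    have : (FreeTwoOp.br k X).compr₂ L = br.compl₁₂ L L := by
      ext u v
      simp [L, FreeTwoOp.br, PWord.value]
    exact fun x y => LinearMap.congr_fun₂ this x y
  have hker : IsMetabelianPoissonIdeal k X (LinearMap.ker L) := by
    obtain ⟨I, -, hI, hQ⟩ := hM
    constructor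
    · intro x y hy
      simp_all
    · intro x hx y
      simp_all
    · intro x y hy
      simp_all
    · intro x hx y
      simp_all
    · intro x y
      simp [Lmul, hP.mul_comm (L x) (L y)]
    · intro x y z
      simp [Lmul, hP.mul_assoc]
    · intro x
      simp [Lbr, hP.br_self]
    · intro x y z
      simp [Lbr, hP.jacobi]
    · intro x y z
      simp [Lbr, Lmul, hP.leibniz]
    · rintro g (rfl | rfl) g' (rfl | rfl) h (rfl | rfl) x y z w <;>
        simp only [LinearMap.mem_ker, Lmul, Lbr]
      · exact (hI _ (hQ _ _).1 _ (hQ _ _).1).1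
      · exact (hI _ (hQ _ _).1 _ (hQ _ _).1).2
      · exact (hI _ (hQ _ _).1 _ (hQ _ _).2).1
      · exact (hI _ (hQ _ _).1 _ (hQ _ _).2).2
      · exact (hI _ (hQ _ _).2 _ (hQ _ _).1).1
      · exact (hI _ (hQ _ _).2 _ (hQ _ _).1).2
      · exact (hI _ (hQ _ _).2 _ (hQ _ _).2).1
      · exact (hI _ (hQ _ _).2 _ (hQ _ _).2).2
  have hle : metabelianPoissonIdeal k X ≤ LinearMap.ker L := sInf_le hker
  let φ : MP k X →ₗ[k] A := (metabelianPoissonIdeal k X).liftQ L hle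
  have hφ : ∀ x, φ (MP.mk k X x) = L x := fun x => rfl
  refine ⟨φ, ⟨?_, ?_, ?_⟩, ?_⟩
  · intro x y
    obtain ⟨x, rfl⟩ := MP.mk_surjective k X x
    obtain ⟨y, rfl⟩ := MP.mk_surjective k X y
    rw [MP.mul_mk, hφ, hφ, hφ, Lmul]
  · intro x y
    obtain ⟨x, rfl⟩ := MP.mk_surjective k X x
    obtain ⟨y, rfl⟩ := MP.mk_surjective k X y
    rw [MP.br_mk, hφ, hφ, hφ, Lbr]
  · intro a
    simp [MP.of, hφ, L, PWord.value]
  · rintro ψ ⟨ψmul, ψbr, ψof⟩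
    have hψ : ψ.comp (MP.mk k X) = L := by
      refine Finsupp.lhom_ext' fun w => LinearMap.ext_ring ?_
      change ψ (MP.mk k X (Finsupp.single w 1)) = L (Finsupp.single w 1)
      induction w with
      | of a => simpa [L, PWord.value, MP.of] using ψof a
      | mul u v hu hv =>
        have h := ψmul (MP.mk k X (Finsupp.single u 1)) (MP.mk k X (Finsupp.single v 1))
        rw [hu, hv, ← Lmul, MP.mul_mk] at h
        simpa [FreeTwoOp.mul] using h
      | br u v hu hv =>
        have h := ψbr (MP.mk k X (Finsupp.single u 1)) (MP.mk k X (Finsupp.single v 1))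
        rw [hu, hv, ← Lbr, MP.br_mk] at h
        simpa [FreeTwoOp.br] using h
    ext x
    obtain ⟨x, rfl⟩ := MP.mk_surjective k X x
    rw [hφ, ← hψ]
    rfl

end Free

/-! ### The words `MPB_k(X)` -/

/-- The pair `(a, [b₁, …, bₘ])` stands for the left-normed bracket `[a, b₁, …, bₘ]`; for `m = 0`
it is the letter `a`. -/
abbrev LieWord (X : Type*) := X × List X

/-- Formal words: left-normed brackets, commutative monomials of degree two and three, and
products of a left-normed bracket with a letter. -/
inductive MPWord (X : Type*) where
  | lie (u : LieWord X) : MPWord X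
  | mon₂ (a b : X) : MPWord X
  | mon₃ (a b c : X) : MPWord X
  | lieMul (u : LieWord X) (c : X) : MPWord X

/-- The element of an algebra with two operations that is denoted by a formal word. -/
def MPWord.eval {k X A : Type*} [Field k] [AddCommGroup A] [Module k A]
    (mul br : A →ₗ[k] A →ₗ[k] A) (f : X → A) : MPWord X → A
  | .lie u => leftNormed br (f u.1) (u.2.map f)
  | .mon₂ a b => mul (f a) (f b)
  | .mon₃ a b c => mul (mul (f a) (f b)) (f c)
  | .lieMul u c => mul (leftNormed br (f u.1) (u.2.map f)) (f c)

section Basis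

variable (k : Type*) (X : Type*) [Field k] [LinearOrder X]

/-- `[a₁, …, aₙ]` with `n ≥ 1`, `a₂ ≤ … ≤ aₙ`, and `a₁ > a₂` if `n ≥ 2`. -/
def Y₁ : Set (MPWord X) :=
  {W | ∃ (a₁ : X) (l : List X), W = .lie (a₁, l) ∧ l.Pairwise (· ≤ ·) ∧ ∀ a₂ ∈ l.head?, a₂ < a₁}

/-- `a₁ ⋯ aₜ` with `2 ≤ t ≤ 3` and `a₁ ≤ … ≤ aₜ`. -/
def Y₂ : Set (MPWord X) :=
  {W | (∃ a₁ a₂, W = .mon₂ a₁ a₂ ∧ a₁ ≤ a₂) ∨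
    ∃ a₁ a₂ a₃, W = .mon₃ a₁ a₂ a₃ ∧ a₁ ≤ a₂ ∧ a₂ ≤ a₃}

/-- `[a₁, a₂] · a₃` with `a₁ > a₂`. -/
def Y₃ : Set (MPWord X) :=
  {W | ∃ a₁ a₂ a₃, W = .lieMul (a₁, [a₂]) a₃ ∧ a₂ < a₁}

/-- `[a₁, a₂, a₃] · a₄` with `a₂ < a₁ ≤ a₄` and `a₂ ≤ a₃ < a₄`. -/
def Y₄ : Set (MPWord X) :=
  {W | ∃ a₁ a₂ a₃ a₄, W = .lieMul (a₁, [a₂, a₃]) a₄ ∧ a₂ < a₁ ∧ a₁ ≤ a₄ ∧ a₂ ≤ a₃ ∧ a₃ < a₄}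

/-- `[a₁, …, aₙ] · aₙ₊₁` with `n ≥ 3`, `a₁ > a₂` and `a₂ ≤ … ≤ aₙ₊₁`; here `l = a₃, …, aₙ`. -/
def Y₅ : Set (MPWord X) :=
  {W | ∃ (a₁ a₂ : X) (l : List X) (c : X), W = .lieMul (a₁, a₂ :: l) c ∧ l ≠ [] ∧ a₂ < a₁ ∧
    (a₂ :: l ++ [c]).Pairwise (· ≤ ·)}

/-- The set `MPB_k(X)`. -/
def MPB : Set (MPWord X) :=
  Y₁ X ∪ Y₂ X ∪ Y₃ X ∪ (if ringChar k = 2 then Y₅ X else Y₄ X)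

end Basis

/-! ### The multiplication table -/

section Table

variable (k : Type*) {X : Type*} [Field k] [LinearOrder X]

/-- The nondecreasing reordering of a sequence of letters. -/
def reorder (l : List X) : List X := l.insertionSort (· ≤ ·)

/-- `{[a₁, …, aₙ], a}`, where `[a₁, …, aₙ]` is in `Y₁`. -/
def lieBr : LieWord X → X → (LieWord X →₀ k)
  | (b, []), a =>
      if a < b then Finsupp.single (b, [a]) 1
      else if b < a then -Finsupp.single (a, [b]) 1
      else 0
  | (a₁, a₂ :: l), a =>
      if a₂ ≤ a then Finsupp.single (a₁, a₂ :: reorder (a :: l)) 1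
      else Finsupp.single (a₁, a :: a₂ :: l) 1 - Finsupp.single (a₂, a :: reorder (a₁ :: l)) 1

/-- `{x, a}` for a linear combination `x` of left-normed brackets. -/
def lieBrLin (x : LieWord X →₀ k) (a : X) : LieWord X →₀ k :=
  Finsupp.linearCombination k (fun u => lieBr k u a) x

/-- `(∑ᵢ αᵢ uᵢ) · c = ∑ᵢ αᵢ (uᵢ · c)` for left-normed brackets `uᵢ`. -/
def dotLetter (x : LieWord X →₀ k) (c : X) : MPWord X →₀ k :=
  Finsupp.linearCombination k (fun u => Finsupp.single (MPWord.lieMul u c) (1 : k)) x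

/-- `[a₁, a₂, d₁, …, dₘ₋₁] · dₘ`, where `d₁ ≤ … ≤ dₘ` is the reordering of the nonempty sequence
`c, l`. -/
def arrowDot (a₁ a₂ c : X) (l : List X) : MPWord X →₀ k :=
  Finsupp.single (MPWord.lieMul (a₁, a₂ :: (reorder (c :: l)).dropLast)
    ((reorder (c :: l)).getLastD c)) 1

/-- `W ∘ a` for a word `W` of `MPB_k(X)` and a letter `a`. -/
def mulLetter : MPWord X → X → (MPWord X →₀ k)
  | .lie (b, []), a => Finsupp.single (.mon₂ (min b a) (max b a)) 1
  | .lie (a₁, [a₂]), a => Finsupp.single (.lieMul (a₁, [a₂]) a) 1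
  | .lie (a₁, a₂ :: a₃ :: l), a =>
      if ringChar k = 2 then
        if a₂ ≤ a then arrowDot k a₁ a₂ a (a₃ :: l)
        else arrowDot k a₁ a a₂ (a₃ :: l) - arrowDot k a₂ a a₁ (a₃ :: l)
      else if l = [] then
        if a₃ = a then 0
        else if a₃ < a then
          if a₁ ≤ a then Finsupp.single (.lieMul (a₁, [a₂, a₃]) a) 1
          else dotLetter k (lieBrLin k (lieBr k (a, []) a₃) a₂) a₁
        else if a₃ < a₁ then dotLetter k (lieBrLin k (lieBr k (a, []) a₃) a₂) a₁
        else if a₁ < a₃ then -dotLetter k (lieBr k (a₁, [a₂]) a) a₃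
        else if a₂ ≤ a then -Finsupp.single (.lieMul (a₃, [a₂, a]) a₁) 1
        else -Finsupp.single (.lieMul (a₃, [a, a₂]) a₁) 1
      else 0
  | .mon₂ a₁ a₂, a =>
      if a ≤ a₁ then Finsupp.single (.mon₃ a a₁ a₂) 1
      else if a ≤ a₂ then Finsupp.single (.mon₃ a₁ a a₂) 1
      else Finsupp.single (.mon₃ a₁ a₂ a) 1
  | .mon₃ _ _ _, _ => 0
  | .lieMul _ _, _ => 0

/-- `{W, a}` for a word `W` of `MPB_k(X)` and a letter `a`. -/
def brLetter : MPWord X → X → (MPWord X →₀ k)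
  | .lie u, a => Finsupp.linearCombination k (fun v => Finsupp.single (MPWord.lie v) (1 : k))
      (lieBr k u a)
  | .mon₂ a₁ a₂, a => dotLetter k (lieBr k (a₁, []) a) a₂ + dotLetter k (lieBr k (a₂, []) a) a₁
  | .mon₃ _ _ _, _ => 0
  | .lieMul (_, []) _, _ => 0
  | .lieMul (a₁, [a₂]) a₃, a =>
      Finsupp.linearCombination k (fun v => mulLetter k (.lie v) a₃) (lieBr k (a₁, [a₂]) a)
  | .lieMul (a₁, a₂ :: a₃ :: l) c, a =>
      if ringChar k = 2 then
        if a₂ ≤ a then arrowDot k a₁ a₂ a (a₃ :: l ++ [c])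
        else Finsupp.single (.lieMul (a₁, a :: a₂ :: a₃ :: l) c) 1 -
          arrowDot k a₂ a a₁ (a₃ :: l ++ [c])
      else 0

/-- The product `W₁ ∘ W₂` of two words of `MPB_k(X)`. -/
def tableMul : MPWord X → MPWord X → (MPWord X →₀ k)
  | W, .lie (a, []) => mulLetter k W a
  | .lie (a, []), W => mulLetter k W a
  | _, _ => 0

/-- The bracket `{W₁, W₂}` of two words of `MPB_k(X)`. -/
def tableBr : MPWord X → MPWord X → (MPWord X →₀ k)
  | W, .lie (a, []) => brLetter k W a
  | .lie (a, []), W => -brLetter k W a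
  | _, _ => 0

/-! The values of the table are linear combinations of words of `MPB_k(X)`. -/

theorem reorder_pairwise (l : List X) : (reorder l).Pairwise (· ≤ ·) :=
  List.pairwise_insertionSort _ l

theorem mem_reorder {l : List X} {x : X} : x ∈ reorder l ↔ x ∈ l := List.mem_insertionSort _

theorem mem_Y₁ {a₁ : X} {l : List X} : MPWord.lie (a₁, l) ∈ Y₁ X ↔
    l.Pairwise (· ≤ ·) ∧ ∀ a₂ ∈ l.head?, a₂ < a₁ := by
  simp [Y₁]

theorem mem_Y₁_cons {a₁ a₂ : X} {l : List X} : MPWord.lie (a₁, a₂ :: l) ∈ Y₁ X ↔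
    a₂ < a₁ ∧ (∀ b ∈ l, a₂ ≤ b) ∧ l.Pairwise (· ≤ ·) := by
  rw [mem_Y₁]
  simp only [List.pairwise_cons, List.head?_cons, Option.mem_def, Option.some.injEq,
    forall_eq']
  tauto

theorem linearCombination_mem_of_supported {k α Y : Type*} [Field k] {N : Submodule k (MPWord Y →₀ k)} {S : Set α}
    {f : α → (MPWord Y →₀ k)} {x : α →₀ k} (hx : x ∈ Finsupp.supported k k S)
    (hf : ∀ u ∈ S, f u ∈ N) : Finsupp.linearCombination k f x ∈ N := by
  rw [Finsupp.linearCombination_apply]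
  exact Submodule.sum_mem _ fun u hu =>
    N.smul_mem _ (hf u ((Finsupp.mem_supported k x).1 hx hu))

theorem lieBr_mem (u : LieWord X) (a : X) (hu : MPWord.lie u ∈ Y₁ X) :
    lieBr k u a ∈ Finsupp.supported k k {v : LieWord X | MPWord.lie v ∈ Y₁ X} := by
  obtain ⟨a₁, _ | ⟨a₂, l⟩⟩ := u
  · simp only [lieBr]
    split_ifs with h h'
    · exact Finsupp.single_mem_supported k _ (mem_Y₁_cons.2 (by simp [h]))
    · exact neg_mem (Finsupp.single_mem_supported k _ (mem_Y₁_cons.2 (by simp [h'])))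
    · exact zero_mem _
  · rw [mem_Y₁_cons] at hu
    obtain ⟨h₁, h₂, h₃⟩ := hu
    simp only [lieBr]
    split_ifs with h
    · refine Finsupp.single_mem_supported k _ (mem_Y₁_cons.2 ⟨h₁, ?_, reorder_pairwise _⟩)
      intro b hb
      rw [mem_reorder, List.mem_cons] at hb
      rcases hb with rfl | hb
      · exact h
      · exact h₂ b hb
    · rw [not_le] at h
      refine sub_mem (Finsupp.single_mem_supported k _ (mem_Y₁_cons.2 ⟨h.trans h₁, ?_, ?_⟩))
        (Finsupp.single_mem_supported k _ (mem_Y₁_cons.2 ⟨h, ?_, reorder_pairwise _⟩))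
      · intro b hb
        rw [List.mem_cons] at hb
        rcases hb with rfl | hb
        · exact h.le
        · exact h.le.trans (h₂ b hb)
      · exact List.pairwise_cons.2 ⟨h₂, h₃⟩
      · intro b hb
        rw [mem_reorder, List.mem_cons] at hb
        rcases hb with rfl | hb
        · exact (h.trans h₁).le
        · exact h.le.trans (h₂ b hb)

theorem Y₁_subset_MPB : Y₁ X ⊆ MPB k X := fun _ h => Or.inl (Or.inl (Or.inl h))

theorem Y₂_subset_MPB : Y₂ X ⊆ MPB k X := fun _ h => Or.inl (Or.inl (Or.inr h))

theorem Y₃_subset_MPB : Y₃ X ⊆ MPB k X := fun _ h => Or.inl (Or.inr h)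

theorem Y₄_subset_MPB (hk : ringChar k ≠ 2) : Y₄ X ⊆ MPB k X := fun _ h =>
  Or.inr (by rwa [if_neg hk])

theorem Y₅_subset_MPB (hk : ringChar k = 2) : Y₅ X ⊆ MPB k X := fun _ h =>
  Or.inr (by rwa [if_pos hk])

theorem arrowDot_mem (hk : ringChar k = 2) {a₁ a₂ c : X} {l : List X} (hl : l ≠ [])
    (h : a₂ < a₁) (hc : a₂ ≤ c) (h' : ∀ b ∈ l, a₂ ≤ b) :
    arrowDot k a₁ a₂ c l ∈ Finsupp.supported k k (MPB k X) := by
  have hlen : (reorder (c :: l)).length = l.length + 1 :=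
    List.length_insertionSort _ _
  have hne : reorder (c :: l) ≠ [] := List.ne_nil_of_length_pos (by omega)
  refine Finsupp.single_mem_supported k _ (Y₅_subset_MPB k hk ⟨a₁, a₂, _, _, rfl, ?_, h, ?_⟩)
  · refine List.ne_nil_of_length_pos ?_
    have := List.length_pos_of_ne_nil hl
    rw [List.length_dropLast]
    omega
  · rw [List.getLastD_eq_getLast?, List.getLast?_eq_getLast_of_ne_nil hne, Option.getD_some,
      List.cons_append, List.dropLast_append_getLast hne, List.pairwise_cons]
    refine ⟨fun b hb => ?_, reorder_pairwise _⟩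
    rw [mem_reorder, List.mem_cons] at hb
    rcases hb with rfl | hb
    · exact hc
    · exact h' b hb

theorem single_mem_Y₄ (hk : ringChar k ≠ 2) {a₁ a₂ a₃ a₄ : X} (h₁ : a₂ < a₁) (h₂ : a₁ ≤ a₄)
    (h₃ : a₂ ≤ a₃) (h₄ : a₃ < a₄) :
    Finsupp.single (MPWord.lieMul (a₁, [a₂, a₃]) a₄) (1 : k) ∈
      Finsupp.supported k k (MPB k X) :=
  Finsupp.single_mem_supported k _
    (Y₄_subset_MPB k hk ⟨a₁, a₂, a₃, a₄, rfl, h₁, h₂, h₃, h₄⟩)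

theorem dotLetter_lieBr_mem (hk : ringChar k ≠ 2) {a₁ a₂ a c : X} (h : a₂ < a₁) (h₁ : a₁ ≤ c)
    (h₂ : a < c) (h₃ : a₁ < c ∨ a₂ ≤ a) :
    dotLetter k (lieBr k (a₁, [a₂]) a) c ∈ Finsupp.supported k k (MPB k X) := by
  simp only [lieBr, reorder, List.insertionSort_cons, List.insertionSort_nil,
    List.orderedInsert_nil]
  split_ifs with ha
  · simpa [dotLetter] using single_mem_Y₄ k hk h h₁ ha h₂
  · rw [not_le] at ha
    have h₃ : a₁ < c := h₃.resolve_right (not_le.2 ha)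
    simpa [dotLetter] using sub_mem
      (single_mem_Y₄ k hk (ha.trans h) h₁ ha.le (h.trans_le h₁))
      (single_mem_Y₄ k hk ha (h.trans_le h₁).le (ha.trans h).le h₃)

theorem dotLetter_lieBrLin_mem (hk : ringChar k ≠ 2) {a b c d : X} (ha : a < d) (hb : b < d)
    (hc : c < d) :
    dotLetter k (lieBrLin k (lieBr k (a, []) b) c) d ∈ Finsupp.supported k k (MPB k X) := by
  simp only [lieBr]
  split_ifs with h h'
  · simpa [lieBrLin] using dotLetter_lieBr_mem k hk h ha.le hc (Or.inl ha)
  · simpa [lieBrLin, dotLetter] using dotLetter_lieBr_mem k hk h' hb.le hc (Or.inl hb)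
  · simp [lieBrLin, dotLetter]

theorem mulLetter_mem (W : MPWord X) (a : X) (hW : W ∈ MPB k X) :
    mulLetter k W a ∈ Finsupp.supported k k (MPB k X) := by
  have hlie : ∀ u, MPWord.lie u ∈ MPB k X → MPWord.lie u ∈ Y₁ X := by
    rintro u (((h | h) | h) | h)
    · exact h
    · simp [Y₂] at h
    · simp [Y₃] at h
    · split_ifs at h <;> simp [Y₄, Y₅] at h
  match W, hW with
  | .lie (b, []), _ =>
    exact Finsupp.single_mem_supported k _ (Y₂_subset_MPB k (Or.inl ⟨_, _, rfl, min_le_max⟩))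
  | .lie (a₁, [a₂]), hW =>
    exact Finsupp.single_mem_supported k _
      (Y₃_subset_MPB k ⟨_, _, _, rfl, (mem_Y₁_cons.1 (hlie _ hW)).1⟩)
  | .lie (a₁, a₂ :: a₃ :: l), hW =>
    obtain ⟨h₁, h₂, h₃⟩ := mem_Y₁_cons.1 (hlie _ hW)
    have h₂₃ : a₂ ≤ a₃ := h₂ a₃ (by simp)
    simp only [mulLetter]
    split_ifs with hk c₁ hl c₂ c₃ c₄ c₅ c₆ c₇
    · exact arrowDot_mem k hk (by simp) h₁ c₁ h₂
    · rw [not_le] at c₁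
      exact sub_mem (arrowDot_mem k hk (by simp) (c₁.trans h₁) c₁.le
          fun b hb => c₁.le.trans (h₂ b hb))
        (arrowDot_mem k hk (by simp) c₁ (c₁.trans h₁).le fun b hb => c₁.le.trans (h₂ b hb))
    · exact zero_mem _
    · exact single_mem_Y₄ k hk h₁ c₄ h₂₃ c₃
    · rw [not_le] at c₄
      exact dotLetter_lieBrLin_mem k hk c₄ (c₃.trans c₄) h₁
    · exact dotLetter_lieBrLin_mem k hk
        ((lt_of_le_of_ne (not_lt.1 c₃) (Ne.symm c₂)).trans c₅) c₅ h₁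
    · exact neg_mem (dotLetter_lieBr_mem k hk h₁ c₆.le
        (lt_of_le_of_ne (not_lt.1 c₃) (Ne.symm c₂)) (Or.inl c₆))
    · obtain rfl : a₁ = a₃ := le_antisymm (not_lt.1 c₅) (not_lt.1 c₆)
      exact neg_mem (single_mem_Y₄ k hk h₁ le_rfl c₇
        (lt_of_le_of_ne (not_lt.1 c₃) (Ne.symm c₂)))
    · obtain rfl : a₁ = a₃ := le_antisymm (not_lt.1 c₅) (not_lt.1 c₆)
      exact neg_mem (single_mem_Y₄ k hk (lt_of_le_of_ne (not_lt.1 c₃) (Ne.symm c₂)) le_rfl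
        (not_le.1 c₇).le h₁)
    · exact zero_mem _
  | .mon₂ a₁ a₂, hW =>
    have h : a₁ ≤ a₂ := by
      rcases hW with ((h | h) | h) | h
      · simp [Y₁] at h
      · simpa [Y₂] using h
      · simp [Y₃] at h
      · split_ifs at h <;> simp [Y₄, Y₅] at h
    simp only [mulLetter]
    split_ifs with c₁ c₂
    · exact Finsupp.single_mem_supported k _
        (Y₂_subset_MPB k (Or.inr ⟨_, _, _, rfl, c₁, h⟩))
    · exact Finsupp.single_mem_supported k _
        (Y₂_subset_MPB k (Or.inr ⟨_, _, _, rfl, (not_le.1 c₁).le, c₂⟩))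
    · exact Finsupp.single_mem_supported k _
        (Y₂_subset_MPB k (Or.inr ⟨_, _, _, rfl, h, (not_le.1 c₂).le⟩))
  | .mon₃ _ _ _, _ => exact zero_mem _
  | .lieMul _ _, _ => exact zero_mem _

theorem brLetter_mem (W : MPWord X) (a : X) (hW : W ∈ MPB k X) :
    brLetter k W a ∈ Finsupp.supported k k (MPB k X) := by
  have hdot : ∀ b c : X, dotLetter k (lieBr k (b, []) a) c ∈
      Finsupp.supported k k (MPB k X) := by
    intro b c
    simp only [lieBr]
    split_ifs with h h'
    · simpa [dotLetter] using Finsupp.single_mem_supported k (1 : k)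
        (Y₃_subset_MPB k (X := X) ⟨b, a, c, rfl, h⟩)
    · simpa [dotLetter] using Finsupp.single_mem_supported k (1 : k)
        (Y₃_subset_MPB k (X := X) ⟨a, b, c, rfl, h'⟩)
    · simp [dotLetter]
  match W, hW with
  | .lie u, hW =>
    have hu : MPWord.lie u ∈ Y₁ X := by
      rcases hW with ((h | h) | h) | h
      · exact h
      · simp [Y₂] at h
      · simp [Y₃] at h
      · split_ifs at h <;> simp [Y₄, Y₅] at h
    exact linearCombination_mem_of_supported (lieBr_mem k u a hu) fun v hv =>
      Finsupp.single_mem_supported k _ (Y₁_subset_MPB k hv)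
  | .mon₂ a₁ a₂, _ => exact add_mem (hdot _ _) (hdot _ _)
  | .mon₃ _ _ _, _ => exact zero_mem _
  | .lieMul (_, []) _, _ => exact zero_mem _
  | .lieMul (a₁, [a₂]) a₃, hW =>
    have h : a₂ < a₁ := by
      rcases hW with ((h | h) | h) | h
      · simp [Y₁] at h
      · simp [Y₂] at h
      · simpa [Y₃] using h
      · split_ifs at h <;> simp [Y₄, Y₅] at h
    exact linearCombination_mem_of_supported (lieBr_mem k (a₁, [a₂]) a (mem_Y₁_cons.2 (by simp [h])))
      fun v hv => mulLetter_mem k _ _ (Y₁_subset_MPB k hv)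
  | .lieMul (a₁, a₂ :: a₃ :: l) c, hW =>
    simp only [brLetter]
    split_ifs with hk c₁
    all_goals try
      have h : a₂ < a₁ ∧ (a₂ :: a₃ :: l ++ [c]).Pairwise (· ≤ ·) := by
        rcases hW with ((h | h) | h) | h
        · simp [Y₁] at h
        · simp [Y₂] at h
        · simp [Y₃] at h
        · rw [if_pos hk] at h
          obtain ⟨b₁, b₂, m, d, he, -, h₁, h₂⟩ := h
          simp only [MPWord.lieMul.injEq, Prod.mk.injEq, List.cons.injEq] at he
          obtain ⟨⟨rfl, rfl, rfl⟩, rfl⟩ := he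
          exact ⟨h₁, h₂⟩
      obtain ⟨h₁, h₂⟩ := h
      have h₃ : ∀ b ∈ a₃ :: l ++ [c], a₂ ≤ b := (List.pairwise_cons.1 h₂).1
    · exact arrowDot_mem k hk (by simp) h₁ c₁ h₃
    · rw [not_le] at c₁
      refine sub_mem (Finsupp.single_mem_supported k _ (Y₅_subset_MPB k hk
        ⟨_, _, _, _, rfl, by simp, c₁.trans h₁, List.pairwise_cons.2 ⟨?_, h₂⟩⟩))
        (arrowDot_mem k hk (by simp) c₁ (c₁.trans h₁).le fun b hb => c₁.le.trans (h₃ b hb))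
      intro b hb
      replace hb : b ∈ a₂ :: (a₃ :: l ++ [c]) := hb
      rw [List.mem_cons] at hb
      rcases hb with rfl | hb
      · exact c₁.le
      · exact c₁.le.trans (h₃ b hb)
    · exact zero_mem _

theorem tableMul_mem (W₁ W₂ : MPB k X) :
    tableMul k W₁.1 W₂.1 ∈ Finsupp.supported k k (MPB k X) := by
  obtain ⟨W₁, h₁⟩ := W₁
  obtain ⟨W₂, h₂⟩ := W₂
  unfold tableMul
  split
  · exact mulLetter_mem k _ _ h₁
  · exact mulLetter_mem k _ _ h₂
  · exact zero_mem _

theorem tableBr_mem (W₁ W₂ : MPB k X) :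
    tableBr k W₁.1 W₂.1 ∈ Finsupp.supported k k (MPB k X) := by
  obtain ⟨W₁, h₁⟩ := W₁
  obtain ⟨W₂, h₂⟩ := W₂
  unfold tableBr
  split
  · exact brLetter_mem k _ _ h₁
  · exact neg_mem (brLetter_mem k _ _ h₂)
  · exact zero_mem _

variable (X)

/-- The vector space with basis `MPB_k(X)`. -/
abbrev KMPB := MPB k X →₀ k

/-- The bilinear operation `∘` on `KMPB k X` given by the multiplication table. -/
def KMPB.mul : KMPB k X →ₗ[k] KMPB k X →ₗ[k] KMPB k X :=
  Finsupp.linearCombination k fun W₁ => Finsupp.linearCombination k fun W₂ =>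
    Finsupp.supportedEquivFinsupp (M := k) (R := k) (MPB k X)
      ⟨tableMul k W₁.1 W₂.1, tableMul_mem k W₁ W₂⟩

/-- The bilinear operation `{-, -}` on `KMPB k X` given by the multiplication table. -/
def KMPB.br : KMPB k X →ₗ[k] KMPB k X →ₗ[k] KMPB k X :=
  Finsupp.linearCombination k fun W₁ => Finsupp.linearCombination k fun W₂ =>
    Finsupp.supportedEquivFinsupp (M := k) (R := k) (MPB k X)
      ⟨tableBr k W₁.1 W₂.1, tableBr_mem k W₁ W₂⟩

end Table

end

noncomputable section

/-! ### Identities of metabelian Poisson algebras -/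

section PoissonIdentities

variable {k A : Type*} [Field k] [AddCommGroup A] [Module k A] {mul br : A →ₗ[k] A →ₗ[k] A}

/-! Let `I` be an ideal that contains all products and brackets and on which both operations vanish.
Each letter acts on `I` by two operators, `x ↦ (x, a)` and `x ↦ x · a`. By Jacobi the bracket
operators commute; by associativity two multiplications compose to zero; by Leibniz brackets commute
with multiplications, and `(x, b · c) = 0` becomes `(x, b) · c = -(x, c) · b`.

If 2 is invertible, `((x, a), b) · c` is symmetric in `a, b` and antisymmetric in `b, c`, hence
zero. What survives is `[a, b, c] · d`, which has the symmetries of a Riemann curvature tensor; the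
words of `Y₄` are its normal forms. In characteristic two the sign disappears, so in `[a₁, …, aₙ] ·
aₙ₊₁` all letters after the second may be permuted. For `n ≥ 3` such products obey the same rules as
the Lie words `[a₁, …, aₙ₊₁]`, and the map `splitLast` carries one theory to the other.

The theorem follows from two facts. The table holds in every metabelian Poisson algebra
(`evalLin_mulLetter`, `evalLin_brLetter`), so evaluation of words is a homomorphism `KMPB.evalHom`
to the free algebra. Conversely, the table satisfies the identities (`KMPB.isPoissonAlgebra`), so
the universal property gives a map back. For the second fact, `isPoissonAlgebra_of_letters` leaves
only identities with at most one argument that is not a letter; the substance is in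
`lieOp_lieBr_comm`, `lieOp_letters_jacobi` and `mulOp_lieOp_skew`.

The two maps are mutually inverse: a word of the basis evaluates to itself in the table algebra
(`KMPB.eval_word`), and the other composite is an endomorphism of the free algebra that fixes the
generators. -/

theorem IsPoissonAlgebra.br_skew (hP : IsPoissonAlgebra mul br) (x y : A) :
    br x y = -br y x := by
  have h := hP.br_self (x + y)
  simp only [map_add, LinearMap.add_apply, hP.br_self, zero_add, add_zero] at h
  exact eq_neg_of_add_eq_zero_right h

theorem IsPoissonAlgebra.br_mul (hP : IsPoissonAlgebra mul br) (x y z : A) :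
    br (mul x y) z = mul (br x z) y + mul (br y z) x := by
  rw [hP.br_skew, hP.leibniz, hP.br_skew z x, hP.br_skew z y, hP.mul_comm x]
  simp only [map_neg, LinearMap.neg_apply]
  abel

/-- An ideal which makes a Poisson algebra metabelian. -/
structure IsMetabelianIdeal (mul br : A →ₗ[k] A →ₗ[k] A) (I : Submodule k A) : Prop where
  mul_eq_zero : ∀ x ∈ I, ∀ y ∈ I, mul x y = 0
  br_eq_zero : ∀ x ∈ I, ∀ y ∈ I, br x y = 0
  mul_mem : ∀ x y, mul x y ∈ I
  br_mem : ∀ x y, br x y ∈ I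

theorem IsMetabelian.exists_ideal (h : IsMetabelian mul br) :
    ∃ I, IsMetabelianIdeal mul br I := by
  obtain ⟨I, -, h₁, h₂⟩ := h
  exact ⟨I, fun x hx y hy => (h₁ x hx y hy).1, fun x hx y hy => (h₁ x hx y hy).2,
    fun x y => (h₂ x y).1, fun x y => (h₂ x y).2⟩

theorem IsMetabelianIdeal.isMetabelian {I : Submodule k A} (h : IsMetabelianIdeal mul br I) :
    IsMetabelian mul br :=
  ⟨I, ⟨fun x y _ => h.mul_mem x y, fun x y _ => h.br_mem x y⟩,
    fun x hx y hy => ⟨h.mul_eq_zero x hx y hy, h.br_eq_zero x hx y hy⟩,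
    fun x y => ⟨h.mul_mem x y, h.br_mem x y⟩⟩

variable {I : Submodule k A}

theorem mul_mul_eq_zero (hP : IsPoissonAlgebra mul br) (hI : IsMetabelianIdeal mul br I) {x : A}
    (hx : x ∈ I) (a b : A) : mul (mul x a) b = 0 := by
  rw [hP.mul_assoc]
  exact hI.mul_eq_zero _ hx _ (hI.mul_mem _ _)

/-- Jacobi, where the term containing `(a, b)` vanishes because both of its arguments lie in `I`. -/
theorem br_br_comm (hP : IsPoissonAlgebra mul br) (hI : IsMetabelianIdeal mul br I) {x : A}
    (hx : x ∈ I) (a b : A) : br (br x a) b = br (br x b) a := by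
  have h := hP.jacobi x a b
  rw [hI.br_eq_zero _ (hI.br_mem a b) x hx, hP.br_skew b x, map_neg, LinearMap.neg_apply] at h
  rwa [add_zero, ← sub_eq_add_neg, sub_eq_zero] at h

theorem br_mul_comm (hP : IsPoissonAlgebra mul br) (hI : IsMetabelianIdeal mul br I) {x : A}
    (hx : x ∈ I) (a c : A) : br (mul x c) a = mul (br x a) c := by
  rw [hP.br_mul, hI.mul_eq_zero _ (hI.br_mem c a) x hx, add_zero]

/-- Leibniz for `(x, b · c)`, which is zero since `b · c` lies in `I`. This relation is what
separates the two characteristics. -/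
theorem mul_br_skew (hP : IsPoissonAlgebra mul br) (hI : IsMetabelianIdeal mul br I) {x : A}
    (hx : x ∈ I) (b c : A) : mul (br x b) c = -mul (br x c) b := by
  have h := hP.leibniz x b c
  rw [hI.br_eq_zero _ hx _ (hI.mul_mem b c), hP.mul_comm b] at h
  exact eq_neg_of_add_eq_zero_left h.symm

/-- The form of Jacobi behind the rules for a letter smaller than the second one: it exchanges `[x,
y, z]` for brackets with `z` in second place. -/
theorem jacobi_sub (hP : IsPoissonAlgebra mul br) (x y z : A) :
    br (br x z) y - br (br y z) x = br (br x y) z := by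
  have h := hP.jacobi x y z
  rw [hP.br_skew z x, map_neg, LinearMap.neg_apply] at h
  rw [← sub_eq_zero, ← neg_eq_zero, ← h]
  abel

theorem mul_br_self (h2 : (2 : k) ≠ 0) (hP : IsPoissonAlgebra mul br)
    (hI : IsMetabelianIdeal mul br I) {x : A} (hx : x ∈ I) (b : A) : mul (br x b) b = 0 := by
  have h := mul_br_skew hP hI hx b b
  rw [eq_neg_iff_add_eq_zero, ← two_smul k] at h
  exact (smul_eq_zero.1 h).resolve_left h2

theorem mul_br_br_eq_zero (h2 : (2 : k) ≠ 0) (hP : IsPoissonAlgebra mul br)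
    (hI : IsMetabelianIdeal mul br I) {x : A} (hx : x ∈ I) (a b c : A) :
    mul (br (br x a) b) c = 0 := by
  have h : mul (br (br x a) b) c = -mul (br (br x a) b) c := by
    -- With `s` the symmetric swap of `a, b` and `t` the antisymmetric swap of `b, c`, the relation
    -- `(st)³ = 1` in the symmetric group returns to the start after three sign changes.
    conv_lhs => rw [mul_br_skew hP hI (hI.br_mem x a), br_br_comm hP hI hx a c,
      mul_br_skew hP hI (hI.br_mem x c), br_br_comm hP hI hx c b,
      mul_br_skew hP hI (hI.br_mem x b), br_br_comm hP hI hx b a]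
    simp
  rw [eq_neg_iff_add_eq_zero, ← two_smul k] at h
  exact (smul_eq_zero.1 h).resolve_left h2

/-- The product `[a, b, c] · d` has the symmetries of a curvature tensor. -/
theorem mul_br_br_pair_symm (h2 : (2 : k) ≠ 0) (hP : IsPoissonAlgebra mul br)
    (hI : IsMetabelianIdeal mul br I) (a b c d : A) :
    mul (br (br a b) c) d = mul (br (br d c) b) a := by
  have J : ∀ x y z w, mul (br (br x y) z) w =
      mul (br (br x z) y) w - mul (br (br y z) x) w := fun x y z w => by
    rw [← jacobi_sub hP x y z, map_sub, LinearMap.sub_apply]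
  have S : ∀ x y z w, mul (br (br x y) z) w = -mul (br (br x y) w) z := fun x y z w =>
    mul_br_skew hP hI (hI.br_mem x y) z w
  have T : ∀ x y z w, mul (br (br x y) z) w = -mul (br (br y x) z) w := fun x y z w => by
    rw [hP.br_skew x y]; simp
  have e1 := J a b c d
  have e2 := J b c d a
  have e3 := J c d a b
  have e4 := J d a b c
  rw [S b c d a, S b d c a, T c d b a] at e2
  rw [S c a d b, S d a c b, T c a b d, T d a b c, S c d a b, T c d b a] at e3
  rw [T d a b c, S d b a c, T d b c a, S a b d c, S b d c a] at e4
  -- The classical derivation of pair symmetry from the first Bianchi identity: the four Jacobi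
  -- relations, one for each omitted letter, are combined so that all other terms cancel by
  -- antisymmetry.
  have key : (2 : k) • (mul (br (br a b) c) d - mul (br (br d c) b) a) = 0 := by
    rw [two_smul]
    linear_combination (norm := module) e1 + e2 - e3 - e4
  exact sub_eq_zero.1 ((smul_eq_zero.1 key).resolve_left h2)

/-! ### Left-normed brackets -/

@[simp]
theorem leftNormed_nil (x : A) : leftNormed br x [] = x := rfl

@[simp]
theorem leftNormed_cons (x y : A) (l : List A) :
    leftNormed br x (y :: l) = leftNormed br (br x y) l := rfl

theorem leftNormed_append (x : A) (l m : List A) :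
    leftNormed br x (l ++ m) = leftNormed br (leftNormed br x l) m := List.foldl_append

theorem leftNormed_sub (x y : A) (l : List A) :
    leftNormed br (x - y) l = leftNormed br x l - leftNormed br y l := by
  induction l generalizing x y with
  | nil => rfl
  | cons a l ih => simp [ih]

theorem leftNormed_mem (hI : IsMetabelianIdeal mul br I) {x : A} (hx : x ∈ I) (l : List A) :
    leftNormed br x l ∈ I := by
  induction l generalizing x with
  | nil => exact hx
  | cons a l ih => exact ih (hI.br_mem x a)

theorem leftNormed_perm (hP : IsPoissonAlgebra mul br) (hI : IsMetabelianIdeal mul br I)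
    {l m : List A} (h : l.Perm m) {x : A} (hx : x ∈ I) :
    leftNormed br x l = leftNormed br x m := by
  induction h generalizing x with
  | nil => rfl
  | cons a _ ih => exact ih (hI.br_mem x a)
  | swap a b l => simp [br_br_comm hP hI hx a b]
  | trans _ _ ih₁ ih₂ => rw [ih₁ hx, ih₂ hx]

theorem br_leftNormed (hP : IsPoissonAlgebra mul br) (hI : IsMetabelianIdeal mul br I)
    {x : A} (hx : x ∈ I) (l : List A) (a : A) :
    br (leftNormed br x l) a = leftNormed br (br x a) l := by
  rw [← leftNormed_cons, ← leftNormed_perm hP hI (List.perm_append_singleton a l) hx,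
    leftNormed_append]
  rfl

/-- Multiplication by a letter commutes with every bracket operator on `I`, so it can be moved to
the innermost place, where the short identities apply. -/
theorem mul_leftNormed (hP : IsPoissonAlgebra mul br) (hI : IsMetabelianIdeal mul br I)
    {x : A} (hx : x ∈ I) (l : List A) (a : A) :
    mul (leftNormed br x l) a = leftNormed br (mul x a) l := by
  induction l generalizing x with
  | nil => rfl
  | cons b l ih => rw [leftNormed_cons, leftNormed_cons, ih (hI.br_mem x b), br_mul_comm hP hI hx]

theorem leftNormed_zero (l : List A) : leftNormed br (0 : A) l = 0 := by
  induction l with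
  | nil => rfl
  | cons a l ih => simp [ih]

/-- In characteristic two the letters of `[x, y₁, …, yₙ₋₁] · yₙ` can be permuted. -/
theorem mul_leftNormed_perm (h2 : (2 : k) = 0) (hP : IsPoissonAlgebra mul br)
    (hI : IsMetabelianIdeal mul br I) {x : A} (hx : x ∈ I) {l m : List A} {c d : A}
    (h : (c :: l).Perm (d :: m)) :
    mul (leftNormed br x l) c = mul (leftNormed br x m) d := by
  have neg_eq : ∀ y : A, -y = y := fun y => by
    rw [neg_eq_iff_add_eq_zero, ← two_smul k, h2, zero_smul]
  by_cases hcd : c = d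
  · subst hcd
    rw [leftNormed_perm hP hI (List.perm_cons c |>.1 h) hx]
  -- If the multipliers differ, `c` occurs in `m` and `d` in `l`. Both lists are arranged so that
  -- this letter is bracketed last; then one use of `mul_br_skew`, with its sign dropped, exchanges
  -- the two.
  · obtain ⟨l₁, l₂, hm⟩ : ∃ l₁ l₂, m = l₁ ++ c :: l₂ := by
      refine List.append_of_mem ?_
      have : c ∈ d :: m := h.subset (by simp)
      simpa [hcd] using this
    subst hm
    have h₁ : (l₁ ++ c :: l₂).Perm (c :: (l₁ ++ l₂)) := List.perm_middle
    have h₂ : l.Perm (d :: (l₁ ++ l₂)) := by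
      rw [← List.perm_cons c]
      exact h.trans ((h₁.cons d).trans (List.Perm.swap _ _ _))
    rw [leftNormed_perm hP hI h₁ hx, leftNormed_perm hP hI h₂ hx, leftNormed_cons,
      leftNormed_cons, ← br_leftNormed hP hI hx, ← br_leftNormed hP hI hx,
      mul_br_skew hP hI (leftNormed_mem hI hx _), neg_eq]

end PoissonIdentities

/-! ### The multiplication table holds in every metabelian Poisson algebra -/

section Eval

variable {k X A : Type*} [Field k] [AddCommGroup A] [Module k A]
  (mul br : A →ₗ[k] A →ₗ[k] A) (f : X → A)

/-- The value of a linear combination of left-normed brackets. -/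
def evalLie : (LieWord X →₀ k) →ₗ[k] A :=
  Finsupp.linearCombination k fun u => leftNormed br (f u.1) (u.2.map f)

/-- The value of a linear combination of formal words. -/
def evalLin : (MPWord X →₀ k) →ₗ[k] A :=
  Finsupp.linearCombination k (MPWord.eval mul br f)

@[simp]
theorem evalLie_single (u : LieWord X) (c : k) :
    evalLie br f (Finsupp.single u c) = c • leftNormed br (f u.1) (u.2.map f) := by
  simp [evalLie]

@[simp]
theorem evalLin_single (W : MPWord X) (c : k) :
    evalLin mul br f (Finsupp.single W c) = c • W.eval mul br f := by
  simp [evalLin]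

theorem evalLin_dotLetter (x : LieWord X →₀ k) (c : X) :
    evalLin mul br f (dotLetter k x c) = mul (evalLie br f x) (f c) := by
  induction x using Finsupp.induction_linear with
  | zero => simp [dotLetter]
  | add x y hx hy =>
    have : dotLetter k (x + y) c = dotLetter k x c + dotLetter k y c := by simp [dotLetter]
    rw [this, map_add, hx, hy, map_add, map_add, LinearMap.add_apply]
  | single u r => simp [dotLetter, MPWord.eval]

variable [LinearOrder X] {mul br} {I : Submodule k A}

theorem reorder_perm (l : List X) : (reorder l).Perm l := List.perm_insertionSort _ l

theorem leftNormed_reorder (hP : IsPoissonAlgebra mul br) (hI : IsMetabelianIdeal mul br I)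
    (a b : A) (l : List X) :
    leftNormed br (br a b) ((reorder l).map f) = leftNormed br (br a b) (l.map f) :=
  leftNormed_perm hP hI ((reorder_perm l).map f) (hI.br_mem a b)

theorem evalLie_lieBr (hP : IsPoissonAlgebra mul br) (hI : IsMetabelianIdeal mul br I)
    (u : LieWord X) (a : X) :
    evalLie br f (lieBr k u a) = br (leftNormed br (f u.1) (u.2.map f)) (f a) := by
  obtain ⟨a₁, _ | ⟨a₂, l⟩⟩ := u
  · simp only [lieBr]
    split_ifs with h h'
    · simp
    · simp [hP.br_skew (f a₁) (f a)]
    · obtain rfl : a = a₁ := le_antisymm (not_lt.1 h') (not_lt.1 h)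
      simp [hP.br_self]
  · simp only [lieBr, List.map_cons, leftNormed_cons, br_leftNormed hP hI (hI.br_mem _ _)]
    split_ifs with h
    · simp [leftNormed_reorder f hP hI]
    · simp [leftNormed_reorder f hP hI, ← leftNormed_sub, jacobi_sub hP]

theorem evalLie_lieBrLin (hP : IsPoissonAlgebra mul br) (hI : IsMetabelianIdeal mul br I)
    (x : LieWord X →₀ k) (a : X) :
    evalLie br f (lieBrLin k x a) = br (evalLie br f x) (f a) := by
  induction x using Finsupp.induction_linear with
  | zero => simp [lieBrLin]
  | add x y hx hy =>
    have : lieBrLin k (x + y) a = lieBrLin k x a + lieBrLin k y a := by simp [lieBrLin]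
    rw [this, map_add, hx, hy, map_add, map_add, LinearMap.add_apply]
  | single u r => simp [lieBrLin, evalLie_lieBr f hP hI]

/-- The default `c` of `getLastD` is never reached, since the reordering of a nonempty list is
nonempty. -/
theorem reorder_cons_eq (c : X) (l : List X) :
    reorder (c :: l) = (reorder (c :: l)).dropLast ++ [(reorder (c :: l)).getLastD c] := by
  have hlen : (reorder (c :: l)).length = l.length + 1 := List.length_insertionSort _ _
  have hne : reorder (c :: l) ≠ [] := List.ne_nil_of_length_pos (by omega)
  rw [List.getLastD_eq_getLast?, List.getLast?_eq_getLast_of_ne_nil hne, Option.getD_some,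
    List.dropLast_append_getLast hne]

theorem evalLin_arrowDot (h2 : (2 : k) = 0) (hP : IsPoissonAlgebra mul br)
    (hI : IsMetabelianIdeal mul br I) (a₁ a₂ c : X) (l : List X) :
    evalLin mul br f (arrowDot k a₁ a₂ c l) =
      mul (leftNormed br (br (f a₁) (f a₂)) (l.map f)) (f c) := by
  rw [arrowDot, evalLin_single, one_smul]
  refine mul_leftNormed_perm h2 hP hI (hI.br_mem _ _) ?_
  rw [← List.map_cons, ← List.map_cons]
  refine List.Perm.map f ((List.perm_append_singleton _ _).symm.trans ?_)
  rw [← reorder_cons_eq]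
  exact reorder_perm _

theorem two_eq_zero (hk : ringChar k = 2) : (2 : k) = 0 := by
  have h := ringChar.Nat.cast_ringChar (R := k)
  rwa [hk, Nat.cast_ofNat] at h

theorem two_ne_zero_of_ringChar (hk : ringChar k ≠ 2) : (2 : k) ≠ 0 := Ring.two_ne_zero hk

/-- Each rule for `∘` is a consequence of the identities. The excluded words `(b, []) · c` are
outside the basis; they denote `b · c`, while the table gives them the junk product `0`. -/
theorem evalLin_mulLetter (hP : IsPoissonAlgebra mul br) (hI : IsMetabelianIdeal mul br I)
    (W : MPWord X) (hW : ∀ b c, W ≠ .lieMul (b, []) c) (a : X) :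
    evalLin mul br f (mulLetter k W a) = mul (W.eval mul br f) (f a) := by
  match W with
  | .lie (b, []) =>
    rcases le_total b a with h | h
    · simp [mulLetter, MPWord.eval, h]
    · simp [mulLetter, MPWord.eval, h, hP.mul_comm (f a)]
  | .lie (a₁, [a₂]) => simp [mulLetter, MPWord.eval]
  | .lie (a₁, a₂ :: a₃ :: l) =>
    by_cases hk : ringChar k = 2
    · have h2 := two_eq_zero hk
      simp only [mulLetter, hk, if_true, MPWord.eval]
      split_ifs with h
      · simp [evalLin_arrowDot f h2 hP hI]
      · have hm : ∀ b c d : X, mul (leftNormed br (br (f b) (f c)) ((a₃ :: l).map f)) (f d) =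
            leftNormed br (mul (br (br (f b) (f c)) (f a₃)) (f d)) (l.map f) := fun b c d => by
          rw [List.map_cons, leftNormed_cons, mul_leftNormed hP hI (hI.br_mem _ _)]
        have hs : ∀ b c d : X, mul (br (br (f b) (f c)) (f a₃)) (f d) =
            -mul (br (br (f b) (f c)) (f d)) (f a₃) := fun b c d =>
          mul_br_skew hP hI (hI.br_mem _ _) _ _
        -- Moving multiplication inside reduces to three brackets. In all three terms `hs` makes
        -- `a₃` the multiplier, and what remains is Jacobi for `a₁, a₂, a`.
        rw [map_sub, evalLin_arrowDot f h2 hP hI, evalLin_arrowDot f h2 hP hI, hm, hm,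
          List.map_cons, leftNormed_cons, hm, ← leftNormed_sub, hs, hs, hs,
          ← jacobi_sub hP (f a₁) (f a₂) (f a)]
        congr 1
        simp only [map_sub, LinearMap.sub_apply]
        abel
    · have h2 := two_ne_zero_of_ringChar hk
      simp only [mulLetter, hk, if_false, MPWord.eval]
      split_ifs with hl c₂ c₃ c₄ c₅ c₆ c₇
      · subst hl c₂
        simp [mul_br_self h2 hP hI (hI.br_mem _ _)]
      · subst hl
        simp [MPWord.eval]
      · subst hl
        -- Here `a₁` is the largest of the letters, and pair symmetry brings it to the multiplier
        -- position required in `Y₄`.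
        simp [evalLin_dotLetter, evalLie_lieBrLin f hP hI, evalLie_lieBr f hP hI,
          mul_br_br_pair_symm h2 hP hI (f a₁)]
      · subst hl
        simp [evalLin_dotLetter, evalLie_lieBrLin f hP hI, evalLie_lieBr f hP hI,
          mul_br_br_pair_symm h2 hP hI (f a₁)]
      · subst hl
        simp [evalLin_dotLetter, evalLie_lieBr f hP hI,
          mul_br_skew hP hI (hI.br_mem (f a₁) (f a₂)) (f a)]
      · obtain rfl : a₁ = a₃ := le_antisymm (not_lt.1 c₅) (not_lt.1 c₆)
        subst hl
        simp [MPWord.eval, mul_br_skew hP hI (hI.br_mem (f a₁) (f a₂)) (f a)]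
      · obtain rfl : a₁ = a₃ := le_antisymm (not_lt.1 c₅) (not_lt.1 c₆)
        subst hl
        simp only [MPWord.eval, map_neg, evalLin_single, one_smul, List.map_cons, List.map_nil,
          leftNormed_cons, leftNormed_nil]
        rw [mul_br_br_pair_symm h2 hP hI (f a₁) (f a₂), hP.br_skew (f a) (f a₁)]
        simp
      -- At least four letters: after the multiplication is moved inside, the inner factor has two
      -- brackets on an element of `I` and vanishes.
      · obtain ⟨a₄, l, rfl⟩ := List.exists_cons_of_ne_nil hl
        simp [mul_leftNormed hP hI (hI.br_mem _ _), leftNormed_zero,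
          mul_br_br_eq_zero h2 hP hI (hI.br_mem _ _)]
  | .mon₂ a₁ a₂ =>
    simp only [mulLetter, MPWord.eval]
    split_ifs
    · simp [MPWord.eval, hP.mul_assoc, hP.mul_comm (f a)]
    · simp [MPWord.eval, hP.mul_assoc, hP.mul_comm (f a)]
    · simp [MPWord.eval]
  | .mon₃ a₁ a₂ a₃ => simp [mulLetter, MPWord.eval, mul_mul_eq_zero hP hI (hI.mul_mem _ _)]
  | .lieMul (a₁, []) c => exact absurd rfl (hW a₁ c)
  | .lieMul (a₁, a₂ :: l) c =>
    simp [mulLetter, MPWord.eval, mul_mul_eq_zero hP hI (leftNormed_mem hI (hI.br_mem _ _) _)]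

theorem evalLin_brLetter (hP : IsPoissonAlgebra mul br) (hI : IsMetabelianIdeal mul br I)
    (W : MPWord X) (hW : ∀ b c, W ≠ .lieMul (b, []) c) (a : X) :
    evalLin mul br f (brLetter k W a) = br (W.eval mul br f) (f a) := by
  match W with
  | .lie u =>
    rw [MPWord.eval, ← evalLie_lieBr f hP hI, brLetter]
    induction lieBr k u a using Finsupp.induction_linear with
    | zero => simp
    | add x y hx hy => rw [map_add, map_add, hx, hy, map_add]
    | single v c => simp [MPWord.eval]
  | .mon₂ a₁ a₂ =>
    simp [brLetter, MPWord.eval, evalLin_dotLetter, evalLie_lieBr f hP hI, hP.br_mul]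
  | .mon₃ a₁ a₂ a₃ =>
    simp [brLetter, MPWord.eval, hP.br_mul, mul_mul_eq_zero hP hI (hI.br_mem _ _),
      hI.mul_eq_zero _ (hI.br_mem _ _) _ (hI.mul_mem _ _)]
  | .lieMul (a₁, []) c => exact absurd rfl (hW a₁ c)
  | .lieMul (a₁, [a₂]) c =>
    have h := evalLie_lieBr f hP hI (a₁, [a₂]) a
    simp only [List.map_cons, List.map_nil, leftNormed_cons, leftNormed_nil] at h
    simp only [brLetter, MPWord.eval, List.map_cons, List.map_nil, leftNormed_cons,
      leftNormed_nil, br_mul_comm hP hI (hI.br_mem _ _), ← h]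
    -- Both sides are linear in the value of `lieBr`, so it may be replaced by an arbitrary
    -- combination of brackets.
    induction lieBr k (a₁, [a₂]) a using Finsupp.induction_linear with
    | zero => simp
    | add x y hx hy =>
      rw [map_add, map_add, hx, hy, map_add, map_add, LinearMap.add_apply]
    | single v c => simp [MPWord.eval, evalLin_mulLetter f hP hI]
  | .lieMul (a₁, a₂ :: a₃ :: l) c =>
    by_cases hk : ringChar k = 2
    · have h2 := two_eq_zero hk
      have hs : ∀ b d e : X, mul (leftNormed br (br (f b) (f d)) ((a₃ :: l ++ [c]).map f)) (f e) =
          mul (leftNormed br (br (f b) (f d)) ((e :: a₃ :: l).map f)) (f c) := fun b d e => by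
        refine mul_leftNormed_perm h2 hP hI (hI.br_mem _ _) ?_
        rw [← List.map_cons, ← List.map_cons]
        refine List.Perm.map f ?_
        exact ((List.perm_append_singleton c (a₃ :: l)).cons e).trans (List.Perm.swap _ _ _)
      simp only [brLetter, hk, if_true, MPWord.eval]
      rw [List.map_cons, leftNormed_cons,
        br_mul_comm hP hI (leftNormed_mem hI (hI.br_mem _ _) _), br_leftNormed hP hI (hI.br_mem _ _)]
      split_ifs with h
      · rw [evalLin_arrowDot f h2 hP hI, hs]
        rfl
      · rw [map_sub, evalLin_arrowDot f h2 hP hI, hs, ← jacobi_sub hP (f a₁) (f a₂) (f a),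
          leftNormed_sub]
        simp [MPWord.eval]
    · have h2 := two_ne_zero_of_ringChar hk
      simp [brLetter, hk, MPWord.eval, mul_leftNormed hP hI (hI.br_mem _ _),
        br_leftNormed hP hI (hI.mul_mem _ _), br_mul_comm hP hI (hI.br_mem _ _),
        mul_br_br_eq_zero h2 hP hI (hI.br_mem _ _), leftNormed_zero]

end Eval

/-! ### The operations of the table on linear combinations of words -/

section TableOperators

variable {k X : Type*} [Field k]

/-- The rules of the table are only meaningful on normal words. This extends an identity checked on
such words to their linear combinations. -/
theorem map_eq_of_supported {α M : Type*} [AddCommGroup M] [Module k M] {S : Set α}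
    {F G : (α →₀ k) →ₗ[k] M}
    (h : ∀ u ∈ S, F (Finsupp.single u 1) = G (Finsupp.single u 1)) {x : α →₀ k}
    (hx : x ∈ Finsupp.supported k k S) : F x = G x := by
  rw [Finsupp.supported_eq_span_single] at hx
  induction hx using Submodule.span_induction with
  | mem _ hx =>
    obtain ⟨u, hu, rfl⟩ := hx
    exact h u hu
  | zero => simp
  | add x y _ _ hx hy => rw [map_add, map_add, hx, hy]
  | smul c x _ hx => rw [map_smul, map_smul, hx]

theorem map_mem_of_supported {α M : Type*} [AddCommGroup M] [Module k M] {S : Set α}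
    {N : Submodule k M} {F : (α →₀ k) →ₗ[k] M}
    (h : ∀ u ∈ S, F (Finsupp.single u 1) ∈ N) {x : α →₀ k}
    (hx : x ∈ Finsupp.supported k k S) : F x ∈ N := by
  rw [Finsupp.supported_eq_span_single] at hx
  have hle : Submodule.span k ((fun u => Finsupp.single u (1 : k)) '' S) ≤ N.comap F := by
    rw [Submodule.span_le]
    rintro _ ⟨u, hu, rfl⟩
    exact h u hu
  exact hle hx

/-- The inclusion of left-normed brackets into words. -/
def lieIncl : (LieWord X →₀ k) →ₗ[k] (MPWord X →₀ k) :=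
  Finsupp.linearCombination k fun v => Finsupp.single (MPWord.lie v) (1 : k)

/-- Formal multiplication of left-normed brackets by a letter. -/
def dotOp (c : X) : (LieWord X →₀ k) →ₗ[k] (MPWord X →₀ k) :=
  Finsupp.linearCombination k fun u => Finsupp.single (MPWord.lieMul u c) (1 : k)

/-- The map `[a₁, …, aₙ] ↦ [a₁, …, aₙ₋₁] · aₙ`. -/
def splitLast : (LieWord X →₀ k) →ₗ[k] (MPWord X →₀ k) :=
  Finsupp.linearCombination k fun u =>
    Finsupp.single (MPWord.lieMul (u.1, u.2.dropLast) (u.2.getLastD u.1)) (1 : k)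

@[simp]
theorem lieIncl_single (u : LieWord X) :
    lieIncl (Finsupp.single u (1 : k)) = Finsupp.single (.lie u) 1 := by simp [lieIncl]

@[simp]
theorem dotOp_single (c : X) (u : LieWord X) :
    dotOp c (Finsupp.single u (1 : k)) = Finsupp.single (.lieMul u c) 1 := by simp [dotOp]

@[simp]
theorem splitLast_single (u : LieWord X) :
    splitLast (Finsupp.single u (1 : k)) =
      Finsupp.single (.lieMul (u.1, u.2.dropLast) (u.2.getLastD u.1)) 1 := by simp [splitLast]

variable [LinearOrder X]

/-- The map `{-, a}` on linear combinations of left-normed brackets. -/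
def lieOp (a : X) : (LieWord X →₀ k) →ₗ[k] (LieWord X →₀ k) :=
  Finsupp.linearCombination k fun u => lieBr k u a

/-- The map `- ∘ a` on linear combinations of words. -/
def mulOp (a : X) : (MPWord X →₀ k) →ₗ[k] (MPWord X →₀ k) :=
  Finsupp.linearCombination k fun W => mulLetter k W a

/-- The map `{-, a}` on linear combinations of words. -/
def brOp (a : X) : (MPWord X →₀ k) →ₗ[k] (MPWord X →₀ k) :=
  Finsupp.linearCombination k fun W => brLetter k W a

@[simp]
theorem lieOp_single (a : X) (u : LieWord X) :
    lieOp a (Finsupp.single u (1 : k)) = lieBr k u a := by simp [lieOp]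

@[simp]
theorem mulOp_single (a : X) (W : MPWord X) :
    mulOp a (Finsupp.single W (1 : k)) = mulLetter k W a := by simp [mulOp]

@[simp]
theorem brOp_single (a : X) (W : MPWord X) :
    brOp a (Finsupp.single W (1 : k)) = brLetter k W a := by simp [brOp]

theorem brOp_lieIncl (x : LieWord X →₀ k) (a : X) : brOp a (lieIncl x) = lieIncl (lieOp a x) :=
  map_eq_of_supported (F := brOp (k := k) a ∘ₗ lieIncl) (G := lieIncl ∘ₗ lieOp (k := k) a)
    (S := Set.univ)
    (fun u _ => by simp [brLetter, lieIncl]) (by simp)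

/-! ### Sorted lists -/

theorem reorder_congr {l m : List X} (h : l.Perm m) : reorder l = reorder m :=
  List.Perm.eq_of_pairwise (fun _ _ _ _ h₁ h₂ => le_antisymm h₁ h₂) (reorder_pairwise l)
    (reorder_pairwise m) ((reorder_perm l).trans (h.trans (reorder_perm m).symm))

theorem reorder_eq_self {l : List X} (h : l.Pairwise (· ≤ ·)) : reorder l = l :=
  List.Perm.eq_of_pairwise (fun _ _ _ _ h₁ h₂ => le_antisymm h₁ h₂) (reorder_pairwise l) h
    (reorder_perm l)

theorem reorder_cons_of_le {a : X} {l : List X} (h : ∀ b ∈ l, a ≤ b) :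
    reorder (a :: l) = a :: reorder l :=
  List.Perm.eq_of_pairwise (fun _ _ _ _ h₁ h₂ => le_antisymm h₁ h₂) (reorder_pairwise _)
    (List.pairwise_cons.2 ⟨fun b hb => h b (mem_reorder.1 hb), reorder_pairwise l⟩)
    ((reorder_perm _).trans ((reorder_perm l).symm.cons a))

theorem reorder_cons_reorder (a : X) (l : List X) : reorder (a :: reorder l) = reorder (a :: l) :=
  reorder_congr ((reorder_perm l).cons a)

theorem reorder_cons_cons (a b : X) (l : List X) :
    reorder (a :: b :: l) = reorder (b :: a :: l) := reorder_congr (.swap _ _ _)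

theorem length_reorder (l : List X) : (reorder l).length = l.length := (reorder_perm l).length_eq

/-! ### The Lie bracket of the table -/

variable (k)

/-- The rule that applies depends only on how `a` and `b` compare with `a₂`. Since `a < b`, three
positions are possible, and in each the two orders of bracketing straighten to the same sorted
words. -/
theorem lieOp_lieBr_comm_of_lt {a₁ a₂ a b : X} {l : List X} (h₁ : a₂ < a₁) (h₂ : ∀ c ∈ l, a₂ ≤ c)
    (h₃ : l.Pairwise (· ≤ ·)) (hab : a < b) :
    lieOp b (lieBr k (a₁, a₂ :: l) a) = lieOp a (lieBr k (a₁, a₂ :: l) b) := by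
  have hl := reorder_eq_self h₃
  rcases le_or_gt a₂ a with h | h
  · simp [lieBr, h, h.trans hab.le, reorder_cons_reorder, reorder_cons_cons]
  · rcases le_or_gt a₂ b with h' | h'
    · have e : reorder (b :: a₂ :: l) = a₂ :: reorder (b :: l) := by
        rw [reorder_cons_cons, reorder_cons_of_le]
        simpa [h'] using h₂
      simp [lieBr, h.not_ge, h', hab.le, reorder_cons_reorder, e, reorder_cons_cons b a₁]
    -- Both letters are below `a₂`. Bracketing with `b` before `a` produces two extra words `[b, a,
    -- …]`, which cancel because their tails have the same reordering.
    · have e : reorder (b :: a₂ :: l) = b :: a₂ :: l := by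
        rw [reorder_cons_of_le, reorder_cons_of_le h₂, hl]
        simpa [h'.le] using fun c hc => h'.le.trans (h₂ c hc)
      have e' : reorder (b :: a₁ :: l) = b :: reorder (a₁ :: l) := by
        rw [reorder_cons_of_le]
        simpa [(h'.trans h₁).le] using fun c hc => h'.le.trans (h₂ c hc)
      simp [lieBr, h.not_ge, h'.not_ge, hab.le, hab.not_ge, reorder_cons_reorder, e, e',
        reorder_cons_cons a₂ a₁]

theorem lieOp_lieBr_comm {u : LieWord X} (hu : MPWord.lie u ∈ Y₁ X) (hu' : u.2 ≠ []) (a b : X) :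
    lieOp b (lieBr k u a) = lieOp a (lieBr k u b) := by
  obtain ⟨a₁, _ | ⟨a₂, l⟩⟩ := u
  · exact absurd rfl hu'
  · obtain ⟨h₁, h₂, h₃⟩ := mem_Y₁_cons.1 hu
    rcases lt_trichotomy a b with h | rfl | h
    · exact lieOp_lieBr_comm_of_lt k h₁ h₂ h₃ h
    · rfl
    · exact (lieOp_lieBr_comm_of_lt k h₁ h₂ h₃ h).symm

theorem lieBr_letter_skew (a b : X) : lieBr k (a, []) b = -lieBr k (b, []) a := by
  rcases lt_trichotomy a b with h | rfl | h
  · simp [lieBr, h, h.not_gt]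
  · simp [lieBr]
  · simp [lieBr, h, h.not_gt]

theorem lieBr_letter_self (a : X) : lieBr k (a, []) a = 0 := by simp [lieBr]

theorem lieOp_letters_jacobi_of_lt {a b c : X} (hab : a < b) (hbc : b < c) :
    lieOp c (lieBr k (a, []) b) + lieOp a (lieBr k (b, []) c) + lieOp b (lieBr k (c, []) a) = 0 := by
  simp [lieBr, hab, hbc, hab.trans hbc, hab.not_gt, hbc.not_gt, hab.le, hab.not_ge,
    (hab.trans hbc).le, reorder]
  abel

theorem lieOp_letters_jacobi (a b c : X) :
    lieOp c (lieBr k (a, []) b) + lieOp a (lieBr k (b, []) c) +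
      lieOp b (lieBr k (c, []) a) = 0 := by
  have key : ∀ x y z : X, x ≤ y → y ≤ z →
      lieOp z (lieBr k (x, []) y) + lieOp x (lieBr k (y, []) z) +
      lieOp y (lieBr k (z, []) x) = 0 := by
    intro x y z h h'
    rcases h.lt_or_eq with h | rfl
    · rcases h'.lt_or_eq with h' | rfl
      · exact lieOp_letters_jacobi_of_lt k h h'
      · rw [lieBr_letter_self, lieBr_letter_skew k x]
        simp
    · rw [lieBr_letter_self, lieBr_letter_skew k x]
      simp
  -- The Jacobi sum is invariant under rotation and changes sign under a transposition, so any order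
  -- of the letters reduces to the sorted case `key`.
  have s : ∀ x y z : X, lieOp z (lieBr k (x, []) y) = -lieOp z (lieBr k (y, []) x) :=
    fun x y z => by rw [lieBr_letter_skew k x, map_neg]
  rcases le_total a b with h₁ | h₁ <;> rcases le_total b c with h₂ | h₂ <;>
    rcases le_total a c with h₃ | h₃
  · exact key a b c h₁ h₂
  · exact key a b c h₁ h₂
  · have := key a c b h₃ h₂
    rw [s a c, s c b, s b a] at this
    linear_combination (norm := module) -this
  · have := key c a b h₃ h₁
    linear_combination (norm := module) this
  · have := key b a c h₁ h₃
    rw [s b a, s a c, s c b] at this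
    linear_combination (norm := module) -this
  · have := key b c a h₂ h₃
    linear_combination (norm := module) this
  · have := key c b a h₂ h₁
    rw [s c b, s b a, s a c] at this
    linear_combination (norm := module) -this
  · have := key c b a h₂ h₁
    rw [s c b, s b a, s a c] at this
    linear_combination (norm := module) -this

theorem lieBr_length_mem (u : LieWord X) (a : X) :
    lieBr k u a ∈ Finsupp.supported k k {v : LieWord X | v.2.length = u.2.length + 1} := by
  obtain ⟨a₁, _ | ⟨a₂, l⟩⟩ := u
  · simp only [lieBr]
    split_ifs
    · exact Finsupp.single_mem_supported k _ (by simp)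
    · exact neg_mem (Finsupp.single_mem_supported k _ (by simp))
    · exact zero_mem _
  · simp only [lieBr]
    split_ifs
    · exact Finsupp.single_mem_supported k _ (by simp [length_reorder])
    · exact sub_mem (Finsupp.single_mem_supported k _ (by simp))
        (Finsupp.single_mem_supported k _ (by simp [length_reorder]))

/-! ### Four letters in characteristic different from two -/

/-- All the forms in which a strict inequality can settle a condition of the table, bundled for
`simp [*]`. -/
theorem lt_facts {a b : X} (h : a < b) :
    a < b ∧ ¬b < a ∧ a ≤ b ∧ ¬b ≤ a ∧ a ≠ b ∧ b ≠ a :=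
  ⟨h, h.not_gt, h.le, h.not_ge, h.ne, h.ne'⟩

/-- The consistency check of the normal form for curvature-like products: antisymmetry in the last
two letters survives straightening. It is verified for each relative position of `b < c` and `a₂ <
a₁`. -/
theorem mulOp_lieBr_skew_of_lt (hk : ringChar k ≠ 2) {a₁ a₂ b c : X} (h : a₂ < a₁) (hbc : b < c) :
    mulOp c (lieIncl (lieBr k (a₁, [a₂]) b)) + mulOp b (lieIncl (lieBr k (a₁, [a₂]) c)) = 0 := by
  have hb := lt_facts hbc
  have ha := lt_facts h
  rcases lt_or_ge b a₂ with h₁ | h₁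
  · have h₁' := lt_facts h₁
    have h₁'' := lt_facts (h₁.trans h)
    rcases lt_trichotomy a₂ c with h₂ | rfl | h₂
    · have h₂' := lt_facts h₂
      rcases lt_trichotomy a₁ c with h₃ | rfl | h₃
      · have h₃' := lt_facts h₃
        simp [lieBr, mulLetter, dotLetter, reorder, *]
      · simp [lieBr, mulLetter, reorder, *]
      · have h₃' := lt_facts h₃
        simp [lieBr, mulLetter, lieBrLin, dotLetter, reorder, *]
    · simp [lieBr, mulLetter, lieBrLin, dotLetter, reorder, *]
    -- With `b < c < a₂ < a₁` the two products straighten to `[c, b, a₂] · a₁` and its negative,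
    -- after terms `[a₂, b, c] · a₁` cancel within each.
    · have h₂' := lt_facts h₂
      have h₂'' := lt_facts (h₂.trans h)
      simp [lieBr, mulLetter, lieBrLin, dotLetter, reorder, *]
      abel
  · have h₂ := h₁.trans_lt hbc
    have h₂' := lt_facts h₂
    rcases lt_trichotomy a₁ c with h₃ | rfl | h₃
    · have h₃' := lt_facts h₃
      simp [lieBr, mulLetter, dotLetter, reorder, *]
    · simp [lieBr, mulLetter, reorder, *]
    · have h₃' := lt_facts h₃
      have h₃'' := lt_facts (hbc.trans h₃)
      simp [lieBr, mulLetter, lieBrLin, dotLetter, reorder, *]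

theorem mulOp_lieBr_self (hk : ringChar k ≠ 2) {a₁ a₂ : X} (h : a₂ < a₁) (b : X) :
    mulOp b (lieIncl (lieBr k (a₁, [a₂]) b)) = 0 := by
  have ha := lt_facts h
  rcases lt_or_ge b a₂ with h₁ | h₁
  · have h₁' := lt_facts h₁
    have h₁'' := lt_facts (h₁.trans h)
    simp [lieBr, mulLetter, lieBrLin, dotLetter, reorder, *]
  · simp [lieBr, mulLetter, reorder, *]

theorem mulOp_lieBr_skew (hk : ringChar k ≠ 2) {a₁ a₂ : X} (h : a₂ < a₁) (b c : X) :
    mulOp c (lieIncl (lieBr k (a₁, [a₂]) b)) + mulOp b (lieIncl (lieBr k (a₁, [a₂]) c)) = 0 := by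
  rcases lt_trichotomy b c with hbc | rfl | hbc
  · exact mulOp_lieBr_skew_of_lt k hk h hbc
  · rw [mulOp_lieBr_self k hk h, add_zero]
  · rw [add_comm]
    exact mulOp_lieBr_skew_of_lt k hk h hbc

end TableOperators

section TableIdentities

variable {k X : Type*} [Field k]

/-! ### Supports of the values of the table -/

/-- The words `u · c`, where `u` is a bracket of at least `n + 1` letters. -/
def lieMulWords (X : Type*) (n : ℕ) : Set (MPWord X) :=
  {W | ∃ (u : LieWord X) (c : X), W = .lieMul u c ∧ n ≤ u.2.length}

theorem dotOp_mem {n : ℕ} {x : LieWord X →₀ k}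
    (hx : x ∈ Finsupp.supported k k {u : LieWord X | n ≤ u.2.length}) (c : X) :
    dotOp c x ∈ Finsupp.supported k k (lieMulWords X n) :=
  map_mem_of_supported (fun u hu => by
    rw [dotOp_single]
    exact Finsupp.single_mem_supported k _ ⟨u, c, rfl, hu⟩) hx

variable [LinearOrder X]

/-- The brackets of `Y₁` with at least `n + 1` letters. -/
def lieWords (X : Type*) [LinearOrder X] (n : ℕ) : Set (LieWord X) :=
  {u | MPWord.lie u ∈ Y₁ X ∧ n ≤ u.2.length}

theorem mulOp_eq_zero {n : ℕ} {x : MPWord X →₀ k}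
    (hx : x ∈ Finsupp.supported k k (lieMulWords X n)) (a : X) : mulOp a x = 0 :=
  map_eq_of_supported (G := 0) (by rintro _ ⟨u, c, rfl, -⟩; simp [mulLetter]) hx

theorem brOp_eq_zero (hk : ringChar k ≠ 2) {x : MPWord X →₀ k}
    (hx : x ∈ Finsupp.supported k k (lieMulWords X 2)) (a : X) : brOp a x = 0 :=
  map_eq_of_supported (G := 0) (by
    rintro _ ⟨⟨a₁, _ | ⟨a₂, _ | ⟨a₃, l⟩⟩⟩, c, rfl, h⟩
    · simp at h
    · simp at h
    · simp [brLetter, hk]) hx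

theorem lieOp_mem_length {n : ℕ} {x : LieWord X →₀ k}
    (hx : x ∈ Finsupp.supported k k {u : LieWord X | n ≤ u.2.length}) (a : X) :
    lieOp a x ∈ Finsupp.supported k k {u : LieWord X | n + 1 ≤ u.2.length} :=
  map_mem_of_supported (fun u hu => by
    rw [lieOp_single]
    refine Finsupp.supported_mono ?_ (lieBr_length_mem k u a)
    intro v (hv : v.2.length = _)
    rw [Set.mem_ofPred_eq] at hu ⊢
    omega) hx

theorem lieBr_mem_length {n : ℕ} {u : LieWord X} (hu : n ≤ u.2.length) (a : X) :
    lieBr k u a ∈ Finsupp.supported k k {v : LieWord X | n + 1 ≤ v.2.length} := by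
  have := lieOp_mem_length (k := k) (Finsupp.single_mem_supported k (1 : k)
    (s := {v : LieWord X | n ≤ v.2.length}) hu) a
  rwa [lieOp_single] at this

theorem lieBr_mem_lieWords {n : ℕ} {u : LieWord X} (hu : u ∈ lieWords X n) (a : X) :
    lieBr k u a ∈ Finsupp.supported k k (lieWords X (n + 1)) := by
  have h : lieWords X (n + 1) = {v | MPWord.lie v ∈ Y₁ X} ∩ {v | n + 1 ≤ v.2.length} := rfl
  rw [h, Finsupp.supported_inter]
  exact ⟨lieBr_mem k u a hu.1, lieBr_mem_length hu.2 a⟩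

theorem lieOp_mem_lieWords {n : ℕ} {x : LieWord X →₀ k}
    (hx : x ∈ Finsupp.supported k k (lieWords X n)) (a : X) :
    lieOp a x ∈ Finsupp.supported k k (lieWords X (n + 1)) :=
  map_mem_of_supported (fun u hu => by
    rw [lieOp_single]
    exact lieBr_mem_lieWords hu a) hx

theorem lieOp_comm {x : LieWord X →₀ k} (hx : x ∈ Finsupp.supported k k (lieWords X 1))
    (a b : X) : lieOp a (lieOp b x) = lieOp b (lieOp a x) :=
  map_eq_of_supported (F := lieOp (k := k) a ∘ₗ lieOp b) (G := lieOp b ∘ₗ lieOp a) (by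
    intro u hu
    simpa using lieOp_lieBr_comm k hu.1 (List.ne_nil_of_length_pos hu.2) b a) hx

/-- The bound is capped at two because a bracket of at least three letters is already the threshold
from which rule 9, rather than rule 8, governs `{-, a}`. -/
theorem mulLetter_lie_mem {a₁ a₂ : X} {l : List X} (a : X) :
    mulLetter k (.lie (a₁, a₂ :: l)) a ∈
      Finsupp.supported k k (lieMulWords X (min 2 (l.length + 1))) := by
  have arrow : ∀ (b₁ b₂ c d : X) (m : List X), arrowDot k b₁ b₂ c (d :: m) ∈
      Finsupp.supported k k (lieMulWords X 2) := fun b₁ b₂ c d m =>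
    Finsupp.single_mem_supported k _ ⟨_, _, rfl, by simp [length_reorder]⟩
  have word : ∀ b₁ b₂ c d : X, Finsupp.single (.lieMul (b₁, [b₂, c]) d) (1 : k) ∈
      Finsupp.supported k k (lieMulWords X 2) := fun b₁ b₂ c d =>
    Finsupp.single_mem_supported k _ ⟨_, _, rfl, by simp⟩
  have dot : ∀ b₁ b₂ c d : X, dotLetter k (lieBrLin k (lieBr k (b₁, []) b₂) c) d ∈
      Finsupp.supported k k (lieMulWords X 2) := fun b₁ b₂ c d =>
    dotOp_mem (lieOp_mem_length (lieBr_mem_length (n := 0) (by simp) _) c) d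
  obtain _ | ⟨a₃, l⟩ := l
  · exact Finsupp.single_mem_supported k _ ⟨_, _, rfl, by simp⟩
  · rw [min_eq_left (by simp)]
    simp only [mulLetter]
    split_ifs
    · exact arrow _ _ _ _ _
    · exact sub_mem (arrow _ _ _ _ _) (arrow _ _ _ _ _)
    · exact zero_mem _
    · exact word _ _ _ _
    · exact dot _ _ _ _
    · exact dot _ _ _ _
    · exact neg_mem (dotOp_mem (lieBr_mem_length (n := 1) (by simp) _) _)
    · exact neg_mem (word _ _ _ _)
    · exact neg_mem (word _ _ _ _)
    · exact zero_mem _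

theorem mulOp_lieIncl_mem {x : LieWord X →₀ k} {n : ℕ} (hn : 1 ≤ n) (hn' : n ≤ 2)
    (hx : x ∈ Finsupp.supported k k (lieWords X n)) (a : X) :
    mulOp a (lieIncl x) ∈ Finsupp.supported k k (lieMulWords X n) :=
  map_mem_of_supported (F := mulOp (k := k) a ∘ₗ lieIncl) (by
    rintro ⟨a₁, _ | ⟨a₂, l⟩⟩ ⟨-, h⟩
    · simp at h
      omega
    · simp only [LinearMap.comp_apply, lieIncl_single, mulOp_single]
      refine Finsupp.supported_mono ?_ (mulLetter_lie_mem a)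
      rintro _ ⟨u, c, rfl, h'⟩
      refine ⟨u, c, rfl, ?_⟩
      simp only [List.length_cons] at h
      omega) hx

theorem mulOp_lieIncl_eq_zero (hk : ringChar k ≠ 2) {x : LieWord X →₀ k}
    (hx : x ∈ Finsupp.supported k k (lieWords X 3)) (a : X) : mulOp a (lieIncl x) = 0 :=
  map_eq_of_supported (F := mulOp (k := k) a ∘ₗ lieIncl) (G := 0) (by
    rintro ⟨a₁, _ | ⟨a₂, _ | ⟨a₃, _ | ⟨a₄, l⟩⟩⟩⟩ ⟨-, h⟩
    · simp at h
    · simp at h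
    · simp at h
    · simp [mulLetter, hk]) hx

theorem brOp_dotOp {x : LieWord X →₀ k}
    (hx : x ∈ Finsupp.supported k k {u : LieWord X | u.2.length = 1}) (a c : X) :
    brOp a (dotOp c x) = mulOp c (lieIncl (lieOp a x)) :=
  map_eq_of_supported (F := brOp (k := k) a ∘ₗ dotOp c)
    (G := mulOp (k := k) c ∘ₗ lieIncl ∘ₗ lieOp a) (by
    rintro ⟨a₁, _ | ⟨a₂, _ | ⟨a₃, l⟩⟩⟩ h
    · simp at h
    · simp only [LinearMap.comp_apply, dotOp_single, brOp_single, lieOp_single, brLetter]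
      refine LinearMap.congr_fun (f := Finsupp.linearCombination k _)
        (g := mulOp (k := k) c ∘ₗ lieIncl) ?_ _
      ext u : 2
      simp
    · simp at h) hx

/-! ### Characteristic two -/

theorem getLastD_concat {α : Type*} (l : List α) (a b : α) : (l ++ [a]).getLastD b = a := by
  simp [List.getLastD_eq_getLast?]

theorem splitLast_single_reorder (a₁ a₂ c : X) (l : List X) :
    splitLast (Finsupp.single (a₁, a₂ :: reorder (c :: l)) (1 : k)) = arrowDot k a₁ a₂ c l := by
  have hne : reorder (c :: l) ≠ [] := List.ne_nil_of_length_pos (by simp [length_reorder])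
  rw [splitLast_single, arrowDot, List.dropLast_cons_of_ne_nil hne]
  congr 2
  obtain ⟨d, m, h⟩ := List.exists_cons_of_ne_nil hne
  simp only [h, List.getLastD_cons]

/-- In characteristic two, rule 7 is rule 4 with the last letter split off. With `brOp_splitLast`,
this deduces identities of long products from the commutation of the operators `lieOp`. -/
theorem mulOp_lieIncl_eq_splitLast (hk : ringChar k = 2) {x : LieWord X →₀ k}
    (hx : x ∈ Finsupp.supported k k (lieWords X 2)) (a : X) :
    mulOp a (lieIncl x) = splitLast (lieOp a x) :=
  map_eq_of_supported (F := mulOp (k := k) a ∘ₗ lieIncl) (G := splitLast ∘ₗ lieOp a) (by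
    rintro ⟨a₁, _ | ⟨a₂, _ | ⟨a₃, l⟩⟩⟩ ⟨hY, h⟩
    · simp at h
    · simp at h
    · obtain ⟨h₁, h₂, h₃⟩ := mem_Y₁_cons.1 hY
      simp only [LinearMap.comp_apply, lieIncl_single, mulOp_single, lieOp_single, mulLetter, hk,
        if_true, lieBr]
      split_ifs with c
      · rw [splitLast_single_reorder]
      -- In the first term `lieBr` leaves the tail `a₂, a₃, …` as it stands while the table reorders
      -- it; it is already sorted.
      · rw [map_sub, splitLast_single_reorder, ← splitLast_single_reorder a₁,
          reorder_cons_of_le h₂, reorder_eq_self h₃]) hx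

/-- Rule 9 is likewise rule 4 after splitting. Four letters are needed so that the remaining bracket
has at least three. -/
theorem brOp_splitLast (hk : ringChar k = 2) {x : LieWord X →₀ k}
    (hx : x ∈ Finsupp.supported k k (lieWords X 3)) (a : X) :
    brOp a (splitLast x) = splitLast (lieOp a x) :=
  map_eq_of_supported (F := brOp (k := k) a ∘ₗ splitLast) (G := splitLast ∘ₗ lieOp a) (by
    rintro ⟨a₁, _ | ⟨a₂, _ | ⟨a₃, m⟩⟩⟩ ⟨hY, h⟩
    · simp at h
    · simp at h
    · obtain ⟨l, c, rfl⟩ : ∃ l c, m = l ++ [c] := by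
        refine ⟨m.dropLast, m.getLast ?_, (List.dropLast_append_getLast _).symm⟩
        rintro rfl
        simp at h
      have e₁ : a₂ :: a₃ :: (l ++ [c]) = (a₂ :: a₃ :: l) ++ [c] := rfl
      have e₂ : a :: (a₂ :: a₃ :: l ++ [c]) = (a :: a₂ :: a₃ :: l) ++ [c] := rfl
      simp only [LinearMap.comp_apply, lieOp_single, lieBr]
      rw [splitLast_single, e₁, getLastD_concat, List.dropLast_concat, brOp_single]
      simp only [brLetter, hk, if_true]
      split_ifs with c
      · rw [splitLast_single_reorder]
        rfl
      · rw [map_sub, splitLast_single_reorder, splitLast_single, e₂, getLastD_concat,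
          List.dropLast_concat]
        rfl) hx

/-! ### Identities of the table on words -/

variable (k) in
-- The division by which operator governs a word. In characteristic two the words of `Y₅` are
-- presented as images under `splitLast`, so that statements about them can be transferred from Lie
-- words.
theorem MPB_cases {W : MPWord X} (hW : W ∈ MPB k X) :
    (∃ a, W = .lie (a, [])) ∨ (∃ u, W = .lie u ∧ u ∈ lieWords X 1) ∨ (∃ a b, W = .mon₂ a b) ∨
    (∃ a b c, W = .mon₃ a b c) ∨ (∃ a b c, W = .lieMul (a, [b]) c ∧ b < a) ∨
    (ringChar k ≠ 2 ∧ W ∈ lieMulWords X 2) ∨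
    (ringChar k = 2 ∧ W ∈ lieMulWords X 2 ∧
      ∃ u ∈ lieWords X 3, Finsupp.single W (1 : k) = splitLast (Finsupp.single u 1)) := by
  rcases hW with ((⟨a, l, rfl, hl⟩ | ⟨a, b, rfl, -⟩ | ⟨a, b, c, rfl, -⟩) | ⟨a, b, c, rfl, h⟩) | hW
  · obtain _ | ⟨b, l⟩ := l
    · exact Or.inl ⟨a, rfl⟩
    · exact Or.inr (Or.inl ⟨_, rfl, mem_Y₁.2 hl, by simp⟩)
  · exact Or.inr (Or.inr (Or.inl ⟨a, b, rfl⟩))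
  · exact Or.inr (Or.inr (Or.inr (Or.inl ⟨a, b, c, rfl⟩)))
  · exact Or.inr (Or.inr (Or.inr (Or.inr (Or.inl ⟨a, b, c, rfl, h⟩))))
  · refine Or.inr (Or.inr (Or.inr (Or.inr (Or.inr ?_))))
    split_ifs at hW with hk
    · obtain ⟨a₁, a₂, l, c, rfl, hl, h₁, h₂⟩ := hW
      have hl' := List.length_pos_of_ne_nil hl
      refine Or.inr ⟨hk, ⟨_, _, rfl, by simp; omega⟩, (a₁, a₂ :: l ++ [c]),
        ⟨mem_Y₁.2 ⟨h₂, by simpa⟩, by simp; omega⟩, ?_⟩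
      rw [splitLast_single, List.dropLast_concat, getLastD_concat]
    · obtain ⟨a₁, a₂, a₃, c, rfl, -⟩ := hW
      exact Or.inl ⟨hk, _, _, rfl, by simp⟩

/-- The words of `MPB_k(X)` that are not letters. -/
def nonletters (k X : Type*) [Field k] [LinearOrder X] : Set (MPWord X) :=
  {W | W ∈ MPB k X ∧ ∀ a, W ≠ .lie (a, [])}

/-- In characteristic two both terms are `splitLast` of the same element, and their sum is twice it.
Otherwise brackets of two letters are covered by `mulOp_lieBr_skew`, and longer ones give zero in
each term. -/
theorem mulOp_lieOp_skew {x : LieWord X →₀ k} (hx : x ∈ Finsupp.supported k k (lieWords X 1))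
    (b c : X) : mulOp c (lieIncl (lieOp b x)) + mulOp b (lieIncl (lieOp c x)) = 0 := by
  by_cases hk : ringChar k = 2
  · rw [mulOp_lieIncl_eq_splitLast hk (lieOp_mem_lieWords hx b),
      mulOp_lieIncl_eq_splitLast hk (lieOp_mem_lieWords hx c), lieOp_comm hx, ← two_smul k,
      two_eq_zero hk, zero_smul]
  · refine map_eq_of_supported (F := mulOp (k := k) c ∘ₗ lieIncl ∘ₗ lieOp b +
      mulOp b ∘ₗ lieIncl ∘ₗ lieOp c) (G := 0) ?_ hx
    rintro ⟨a₁, _ | ⟨a₂, _ | ⟨a₃, l⟩⟩⟩ hu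
    · simp [lieWords] at hu
    · simpa using mulOp_lieBr_skew k hk (mem_Y₁_cons.1 hu.1).1 b c
    · have h : (a₁, a₂ :: a₃ :: l) ∈ lieWords X 2 := ⟨hu.1, by simp⟩
      simp only [LinearMap.add_apply, LinearMap.comp_apply, lieOp_single,
        mulOp_lieIncl_eq_zero hk (lieBr_mem_lieWords h _), add_zero, LinearMap.zero_apply]

theorem brLetter_mon₂ (a₁ a₂ a : X) : brLetter k (.mon₂ a₁ a₂) a =
    dotOp a₂ (lieBr k (a₁, []) a) + dotOp a₁ (lieBr k (a₂, []) a) := rfl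

theorem letter_mem_lieWords (a : X) : (a, []) ∈ lieWords X 0 :=
  ⟨mem_Y₁.2 (by simp), by simp⟩

theorem brLetter_lieMul (a₁ a₂ c a : X) : brLetter k (.lieMul (a₁, [a₂]) c) a =
    mulOp c (lieIncl (lieBr k (a₁, [a₂]) a)) := by
  have h := brOp_dotOp (k := k) (x := Finsupp.single (a₁, [a₂]) 1)
    (Finsupp.single_mem_supported k _ (by simp)) a c
  simpa using h

theorem brLetter_lieMulWords_mem {W : MPWord X} (hW : W ∈ nonletters k X)
    (hW' : W ∈ lieMulWords X 0) (a : X) :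
    brLetter k W a ∈ Finsupp.supported k k (lieMulWords X 2) := by
  obtain ⟨u, c, rfl, -⟩ := hW'
  rcases MPB_cases k hW.1 with ⟨a, h⟩ | ⟨u, h, hu⟩ | ⟨a, b, h⟩ | ⟨a, b, c, h⟩ | ⟨a₁, a₂, c, h, hlt⟩ |
    ⟨hk, hW⟩ | ⟨hk, -, v, hv, h⟩
  · cases h
  · cases h
  · cases h
  · cases h
  · rw [h, brLetter_lieMul]
    exact mulOp_lieIncl_mem (by norm_num) le_rfl (lieBr_mem_lieWords (n := 1)
      ⟨mem_Y₁_cons.2 (by simp [hlt]), by simp⟩ a) c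
  · rw [← brOp_single, brOp_eq_zero hk (Finsupp.single_mem_supported k _ hW)]
    exact zero_mem _
  · rw [← brOp_single, h, brOp_splitLast hk (Finsupp.single_mem_supported k _ hv), lieOp_single]
    refine map_mem_of_supported (fun v hv => ?_) (lieBr_mem_lieWords hv a)
    rw [splitLast_single]
    refine Finsupp.single_mem_supported k _ ⟨_, _, rfl, ?_⟩
    have := hv.2
    simp
    omega

theorem mulOp_mulOp_eq_zero {W : MPWord X} (hW : W ∈ nonletters k X) (a b : X) :
    mulOp b (mulLetter k W a) = 0 := by
  match W, hW with
  | .lie (c, []), hW => exact absurd rfl (hW.2 c)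
  | .lie (a₁, a₂ :: l), _ => exact mulOp_eq_zero (mulLetter_lie_mem a) b
  | .mon₂ a₁ a₂, _ =>
    simp only [mulLetter]
    split_ifs <;> simp [mulLetter]
  | .mon₃ _ _ _, _ => simp [mulLetter]
  | .lieMul _ _, _ => simp [mulLetter]

theorem lie_mem_lieWords {a₁ a₂ : X} {l : List X}
    (hW : MPWord.lie (a₁, a₂ :: l) ∈ MPB k X) : (a₁, a₂ :: l) ∈ lieWords X 1 := by
  rcases MPB_cases k hW with ⟨a, h⟩ | ⟨u, h, hu⟩ | ⟨a, b, h⟩ | ⟨a, b, c, h⟩ | ⟨a, b, c, h, -⟩ |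
    ⟨-, u, c, h, -⟩ | ⟨-, ⟨u, c, h, -⟩, -⟩ <;> cases h
  exact hu

theorem mulOp_brLetter_mon₂ (a₁ a₂ a b : X) : mulOp b (brLetter k (.mon₂ a₁ a₂) a) = 0 := by
  rw [brLetter_mon₂]
  exact mulOp_eq_zero (add_mem (dotOp_mem (lieBr_mem_length (n := 0) (by simp) a) a₂)
    (dotOp_mem (lieBr_mem_length (n := 0) (by simp) a) a₁)) b

theorem brLetter_lie (u : LieWord X) (a : X) :
    brLetter k (.lie u) a = lieIncl (lieBr k u a) := rfl

theorem mulOp_brLetter_skew {W : MPWord X} (hW : W ∈ nonletters k X) (b c : X) :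
    mulOp c (brLetter k W b) + mulOp b (brLetter k W c) = 0 := by
  match W, hW with
  | .lie (a, []), hW => exact absurd rfl (hW.2 a)
  | .lie (a₁, a₂ :: l), hW =>
    simpa [brLetter_lie] using mulOp_lieOp_skew
      (Finsupp.single_mem_supported k (1 : k) (lie_mem_lieWords hW.1)) b c
  | .mon₂ a₁ a₂, _ => rw [mulOp_brLetter_mon₂, mulOp_brLetter_mon₂, add_zero]
  | .mon₃ _ _ _, _ => simp [brLetter]
  | .lieMul u d, hW =>
    rw [mulOp_eq_zero (brLetter_lieMulWords_mem hW ⟨u, d, rfl, by simp⟩ b),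
      mulOp_eq_zero (brLetter_lieMulWords_mem hW ⟨u, d, rfl, by simp⟩ c), add_zero]

/-- In characteristic two both sides are `splitLast` of two commuting bracket operators applied to
`x`; otherwise both sides vanish. -/
theorem brOp_mulOp_lieIncl {x : LieWord X →₀ k} (hx : x ∈ Finsupp.supported k k (lieWords X 2))
    (a c : X) : brOp a (mulOp c (lieIncl x)) = mulOp c (lieIncl (lieOp a x)) := by
  by_cases hk : ringChar k = 2
  · rw [mulOp_lieIncl_eq_splitLast hk hx, brOp_splitLast hk (lieOp_mem_lieWords hx c),
      mulOp_lieIncl_eq_splitLast hk (Finsupp.supported_mono ?_ (lieOp_mem_lieWords hx a)),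
      lieOp_comm (Finsupp.supported_mono ?_ hx)]
    · exact fun u hu => ⟨hu.1, le_trans (by norm_num) hu.2⟩
    · exact fun u hu => ⟨hu.1, le_trans (by norm_num) hu.2⟩
  · rw [brOp_eq_zero hk (mulOp_lieIncl_mem (by norm_num) le_rfl hx c),
      mulOp_lieIncl_eq_zero hk (lieOp_mem_lieWords hx a)]

theorem brOp_mulLetter_comm {W : MPWord X} (hW : W ∈ nonletters k X) (a c : X) :
    brOp a (mulLetter k W c) = mulOp c (brLetter k W a) := by
  match W, hW with
  | .lie (b, []), hW => exact absurd rfl (hW.2 b)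
  | .lie (a₁, [a₂]), hW => rw [brLetter_lie, ← brLetter_lieMul, ← brOp_single]; rfl
  | .lie (a₁, a₂ :: a₃ :: l), hW =>
    have h : (a₁, a₂ :: a₃ :: l) ∈ lieWords X 2 := ⟨(lie_mem_lieWords hW.1).1, by simp⟩
    simpa [brLetter_lie] using brOp_mulOp_lieIncl (Finsupp.single_mem_supported k (1 : k) h) a c
  | .mon₂ a₁ a₂, _ =>
    rw [mulOp_brLetter_mon₂]
    simp only [mulLetter]
    split_ifs <;> simp [brLetter]
  | .mon₃ _ _ _, _ => simp [mulLetter, brLetter]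
  | .lieMul u d, hW =>
    rw [mulOp_eq_zero (brLetter_lieMulWords_mem hW ⟨u, d, rfl, by simp⟩ a)]
    simp [mulLetter]

theorem brOp_brLetter_mon₂ (a₁ a₂ a b : X) : brOp b (brLetter k (.mon₂ a₁ a₂) a) =
    mulOp a₂ (lieIncl (lieOp b (lieBr k (a₁, []) a))) +
      mulOp a₁ (lieIncl (lieOp b (lieBr k (a₂, []) a))) := by
  rw [brLetter_mon₂, map_add, brOp_dotOp (by simpa using lieBr_length_mem k (a₁, []) a),
    brOp_dotOp (by simpa using lieBr_length_mem k (a₂, []) a)]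

theorem brOp_brLetter_comm {W : MPWord X} (hW : W ∈ nonletters k X) (a b : X) :
    brOp b (brLetter k W a) = brOp a (brLetter k W b) := by
  match W, hW with
  | .lie (b, []), hW => exact absurd rfl (hW.2 b)
  | .lie (a₁, a₂ :: l), hW =>
    rw [brLetter_lie, brLetter_lie, brOp_lieIncl, brOp_lieIncl,
      lieOp_lieBr_comm k (lie_mem_lieWords hW.1).1 (by simp)]
  | .mon₂ a₁ a₂, _ =>
    -- By Jacobi, interchanging `a` and `b` changes the two summands by `(((a, b), a₁)) · a₂` and
    -- `(((a, b), a₂)) · a₁`, whose sum is zero by `mulOp_lieOp_skew`.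
    have J : ∀ c : X, lieOp b (lieBr k (c, []) a) =
        lieOp a (lieBr k (c, []) b) - lieOp c (lieBr k (a, []) b) := fun c => by
      have h := lieOp_letters_jacobi k c a b
      rw [lieBr_letter_skew k b c, map_neg] at h
      linear_combination (norm := module) h
    have h := mulOp_lieOp_skew (k := k) (lieBr_mem_lieWords (letter_mem_lieWords a) b) a₁ a₂
    rw [brOp_brLetter_mon₂, brOp_brLetter_mon₂, J, J]
    simp only [map_sub]
    linear_combination (norm := module) -h
  | .mon₃ _ _ _, _ => simp [brLetter]
  | .lieMul u d, hW =>
    by_cases hk : ringChar k = 2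
    · rcases MPB_cases k hW.1 with ⟨a, h⟩ | ⟨u, h, hu⟩ | ⟨a, b, h⟩ | ⟨a, b, c, h⟩ |
        ⟨a₁, a₂, c, h, hlt⟩ | ⟨hk', -⟩ | ⟨-, -, v, hv, h⟩
      · cases h
      · cases h
      · cases h
      · cases h
      · have hu : (a₁, [a₂]) ∈ lieWords X 1 := ⟨mem_Y₁_cons.2 (by simp [hlt]), by simp⟩
        rw [h, brLetter_lieMul, brLetter_lieMul, brOp_mulOp_lieIncl (lieBr_mem_lieWords hu _),
          brOp_mulOp_lieIncl (lieBr_mem_lieWords hu _), lieOp_lieBr_comm k hu.1 (by simp)]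
      · exact absurd hk hk'
      · have hv' := Finsupp.single_mem_supported k (1 : k) hv
        have hv₁ : Finsupp.single v (1 : k) ∈ Finsupp.supported k k (lieWords X 1) :=
          Finsupp.single_mem_supported k _ ⟨hv.1, le_trans (by norm_num) hv.2⟩
        have hv₂ : ∀ c, lieOp c (Finsupp.single v (1 : k)) ∈ Finsupp.supported k k (lieWords X 3) :=
          fun c => Finsupp.supported_mono
            (show lieWords X 4 ⊆ lieWords X 3 from fun u hu => ⟨hu.1, le_trans (by norm_num) hu.2⟩)
            (lieOp_mem_lieWords hv' c)
        rw [← brOp_single, ← brOp_single, h, brOp_splitLast hk hv', brOp_splitLast hk hv',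
          brOp_splitLast hk (hv₂ a), brOp_splitLast hk (hv₂ b), lieOp_comm hv₁]
    · rw [brOp_eq_zero hk (brLetter_lieMulWords_mem hW ⟨u, d, rfl, by simp⟩ a),
        brOp_eq_zero hk (brLetter_lieMulWords_mem hW ⟨u, d, rfl, by simp⟩ b)]

/-! ### Identities of the table on letters -/

theorem mulLetter_letter_comm (a b : X) :
    mulLetter k (.lie (a, [])) b = mulLetter k (.lie (b, [])) a := by
  simp [mulLetter, min_comm, max_comm]

/-- Associativity in cyclic form: given commutativity it is equivalent, and it needs only
multiplication by a letter on the right. -/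
theorem mulOp_letters_cycle (a b c : X) :
    mulOp c (mulLetter k (.lie (a, [])) b) = mulOp a (mulLetter k (.lie (b, [])) c) := by
  have key : ∀ x y z : X, x ≤ y → mulOp z (mulLetter k (.lie (x, [])) y) =
      Finsupp.single (if z ≤ x then .mon₃ z x y else if z ≤ y then .mon₃ x z y else
        .mon₃ x y z) 1 := fun x y z h => by
    simp only [mulLetter, mulOp_single, min_eq_left h, max_eq_right h]
    split_ifs <;> rfl
  rcases le_total a b with h | h <;> rcases le_total b c with h' | h'
  · rw [key a b c h, key b c a h']
    clear key
    grind
  · rw [mulLetter_letter_comm b c, key a b c h, key c b a h']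
    clear key
    grind
  · rw [mulLetter_letter_comm a b, key b a c h, key b c a h']
    clear key
    grind
  · rw [mulLetter_letter_comm a b, mulLetter_letter_comm b c, key b a c h, key c b a h']
    clear key
    grind

theorem brOp_letters_jacobi (a b c : X) :
    brOp c (brLetter k (.lie (a, [])) b) + brOp a (brLetter k (.lie (b, [])) c) +
      brOp b (brLetter k (.lie (c, [])) a) = 0 := by
  simp only [brLetter_lie, brOp_lieIncl, ← map_add]
  rw [lieOp_letters_jacobi, map_zero]

theorem mulOp_brLetter_letter (a b c : X) :
    mulOp c (brLetter k (.lie (a, [])) b) = dotOp c (lieBr k (a, []) b) := by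
  rw [brLetter_lie]
  exact map_eq_of_supported (F := mulOp (k := k) c ∘ₗ lieIncl) (by
    rintro ⟨a₁, _ | ⟨a₂, _ | ⟨a₃, l⟩⟩⟩ h
    · simp at h
    · simp [mulLetter]
    · simp at h) (lieBr_length_mem k (a, []) b)

theorem brOp_mulLetter_letter (a b c : X) :
    brOp a (mulLetter k (.lie (b, [])) c) =
      mulOp c (brLetter k (.lie (b, [])) a) + mulOp b (brLetter k (.lie (c, [])) a) := by
  rw [mulOp_brLetter_letter, mulOp_brLetter_letter]
  rcases le_total b c with h | h
  · simp [mulLetter, h, brLetter_mon₂]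
  · simp [mulLetter, h, brLetter_mon₂, add_comm]

end TableIdentities

/-! ### A criterion for metabelian Poisson algebras -/

section Criterion

variable {k A : Type*} [Field k] [AddCommGroup A] [Module k A]

theorem trilinear_eq_zero {S : Set A} (hS : Submodule.span k S = ⊤) (D : A → A → A → A)
    (h₁ : ∀ y z, IsLinearMap k fun x => D x y z) (h₂ : ∀ x z, IsLinearMap k fun y => D x y z)
    (h₃ : ∀ x y, IsLinearMap k fun z => D x y z)
    (h : ∀ x ∈ S, ∀ y ∈ S, ∀ z ∈ S, D x y z = 0) (x y z : A) : D x y z = 0 := by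
  have ext : ∀ g : A → A, IsLinearMap k g → (∀ x ∈ S, g x = 0) → ∀ x, g x = 0 := by
    intro g hg h x
    have : hg.mk' g = 0 := LinearMap.ext_on hS h
    exact LinearMap.congr_fun this x
  exact ext _ (h₁ y z) (fun x hx => ext _ (h₂ x z) (fun y hy => ext _ (h₃ x y) (h x hx y hy) z) y) x

variable {mul br : A →ₗ[k] A →ₗ[k] A}

/-- The defining identities of metabelian Poisson algebras hold if they hold for the letters `f`
and for a set `J` of elements such that the letters and `J` span the algebra. -/
theorem isPoissonAlgebra_of_letters {X : Type*} (f : X → A) (J : Set A)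
    (hS : Submodule.span k (Set.range f ∪ J) = ⊤)
    (mul_comm : ∀ x y, mul x y = mul y x) (br_self : ∀ x, br x x = 0)
    (hI : IsMetabelianIdeal mul br (Submodule.span k J))
    (mul_letters : ∀ a b c, mul (mul (f a) (f b)) (f c) = mul (mul (f b) (f c)) (f a))
    (mul_mul : ∀ x ∈ J, ∀ a b, mul (mul x (f a)) (f b) = 0)
    (br_letters : ∀ a b c, br (br (f a) (f b)) (f c) + br (br (f b) (f c)) (f a) +
      br (br (f c) (f a)) (f b) = 0)
    (br_br : ∀ x ∈ J, ∀ a b, br (br x (f a)) (f b) = br (br x (f b)) (f a))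
    (br_mul_letters : ∀ a b c, br (mul (f b) (f c)) (f a) =
      mul (br (f b) (f a)) (f c) + mul (br (f c) (f a)) (f b))
    (br_mul : ∀ x ∈ J, ∀ a c, br (mul x (f c)) (f a) = mul (br x (f a)) (f c))
    (mul_br : ∀ x ∈ J, ∀ b c, mul (br x (f b)) (f c) + mul (br x (f c)) (f b) = 0) :
    IsPoissonAlgebra mul br := by
  have skew : ∀ x y, br x y = -br y x := fun x y => by
    have h := br_self (x + y)
    simp only [map_add, LinearMap.add_apply, br_self, zero_add, add_zero] at h
    exact eq_neg_of_add_eq_zero_right h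
  have hJ : ∀ {x}, x ∈ J → x ∈ Submodule.span k J := fun hx => Submodule.subset_span hx
  refine ⟨mul_comm, ?_, br_self, ?_, ?_⟩
  · intro x y z
    rw [← sub_eq_zero]
    refine trilinear_eq_zero hS (fun x y z => mul (mul x y) z - mul x (mul y z)) ?_ ?_ ?_ ?_ x y z
    · exact fun y z => ⟨fun _ _ => by simp; module, fun _ _ => by simp; module⟩
    · exact fun y z => ⟨fun _ _ => by simp; module, fun _ _ => by simp; module⟩
    · exact fun y z => ⟨fun _ _ => by simp; module, fun _ _ => by simp; module⟩
    -- Eight cases, according to which arguments are letters. Two arguments from `J` make both sides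
    -- vanish; the others are hypotheses up to commutativity.
    · rintro _ (⟨a, rfl⟩ | hx) _ (⟨b, rfl⟩ | hy) _ (⟨c, rfl⟩ | hz)
      · rw [mul_comm (f a) (mul _ _), mul_letters, sub_self]
      · rw [hI.mul_eq_zero _ (hI.mul_mem _ _) _ (hJ hz), mul_comm (f a) (mul _ _), mul_comm (f b),
          mul_mul _ hz, sub_zero]
      · rw [mul_comm (f a), mul_mul _ hy, mul_comm (f a), mul_mul _ hy, sub_zero]
      · rw [hI.mul_eq_zero _ (hI.mul_mem _ _) _ (hJ hz), hI.mul_eq_zero _ (hJ hy) _ (hJ hz)]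
        simp
      · rw [mul_mul _ hx, hI.mul_eq_zero _ (hJ hx) _ (hI.mul_mem _ _), sub_zero]
      · rw [hI.mul_eq_zero _ (hI.mul_mem _ _) _ (hJ hz),
          hI.mul_eq_zero _ (hJ hx) _ (hI.mul_mem _ _), sub_zero]
      · rw [hI.mul_eq_zero _ (hJ hx) _ (hJ hy), hI.mul_eq_zero _ (hJ hx) _ (hI.mul_mem _ _)]
        simp
      · rw [hI.mul_eq_zero _ (hJ hx) _ (hJ hy), hI.mul_eq_zero _ (hJ hx) _ (hI.mul_mem _ _)]
        simp
  · have one : ∀ x ∈ J, ∀ a b, br (br x (f a)) (f b) + br (br (f a) (f b)) x +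
        br (br (f b) x) (f a) = 0 := fun x hx a b => by
      rw [br_br x hx, skew (f b) x, hI.br_eq_zero _ (hI.br_mem (f a) (f b)) _ (hJ hx)]
      simp
    have two : ∀ x ∈ J, ∀ y ∈ J, ∀ z, br (br x y) z + br (br y z) x + br (br z x) y = 0 :=
      fun x hx y hy z => by
        rw [hI.br_eq_zero _ (hJ hx) _ (hJ hy), hI.br_eq_zero _ (hI.br_mem y z) _ (hJ hx),
          hI.br_eq_zero _ (hI.br_mem z x) _ (hJ hy)]
        simp
    refine trilinear_eq_zero hS (fun x y z => br (br x y) z + br (br y z) x + br (br z x) y)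
      ?_ ?_ ?_ ?_
    · exact fun y z => ⟨fun _ _ => by simp; module, fun _ _ => by simp⟩
    · exact fun y z => ⟨fun _ _ => by simp; module, fun _ _ => by simp⟩
    · exact fun y z => ⟨fun _ _ => by simp; module, fun _ _ => by simp⟩
    · rintro _ (⟨a, rfl⟩ | hx) _ (⟨b, rfl⟩ | hy) _ (⟨c, rfl⟩ | hz)
      · exact br_letters a b c
      -- The Jacobi sum is invariant under rotation, so the arguments may be rotated until those in
      -- `J` come first.
      · linear_combination (norm := module) one _ hz a b
      · linear_combination (norm := module) one _ hy c a
      · linear_combination (norm := module) two _ hy _ hz (f a)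
      · exact one _ hx b c
      · linear_combination (norm := module) two _ hz _ hx (f b)
      · exact two _ hx _ hy _
      · exact two _ hx _ hy _
  · intro x y z
    rw [← sub_eq_zero]
    refine trilinear_eq_zero hS
      (fun x y z => br x (mul y z) - (mul (br x y) z + mul y (br x z))) ?_ ?_ ?_ ?_ x y z
    · exact fun y z => ⟨fun _ _ => by simp; module, fun _ _ => by simp; module⟩
    · exact fun y z => ⟨fun _ _ => by simp; module, fun _ _ => by simp; module⟩
    · exact fun y z => ⟨fun _ _ => by simp; module, fun _ _ => by simp; module⟩
    · rintro _ (⟨a, rfl⟩ | hx) _ (⟨b, rfl⟩ | hy) _ (⟨c, rfl⟩ | hz)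
      · rw [skew (f a), skew (f a), skew (f a), br_mul_letters, mul_comm (f b)]
        simp only [map_neg, LinearMap.neg_apply]
        abel
      · rw [skew (f a), mul_comm (f b), br_mul _ hz, hI.mul_eq_zero _ (hI.br_mem _ _) _ (hJ hz),
          mul_comm (f b), skew (f a)]
        simp
      · rw [skew (f a), br_mul _ hy, hI.mul_eq_zero _ (hJ hy) _ (hI.br_mem _ _), skew (f a)]
        simp
      · rw [hI.mul_eq_zero _ (hJ hy) _ (hJ hz), hI.mul_eq_zero _ (hI.br_mem _ _) _ (hJ hz),
          hI.mul_eq_zero _ (hJ hy) _ (hI.br_mem _ _)]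
        simp
      · rw [hI.br_eq_zero _ (hJ hx) _ (hI.mul_mem _ _), mul_comm (f b), mul_br _ hx, sub_zero]
      · rw [hI.br_eq_zero _ (hJ hx) _ (hI.mul_mem _ _), hI.br_eq_zero _ (hJ hx) _ (hJ hz),
          hI.mul_eq_zero _ (hI.br_mem _ _) _ (hJ hz)]
        simp
      · rw [hI.br_eq_zero _ (hJ hx) _ (hI.mul_mem _ _), hI.br_eq_zero _ (hJ hx) _ (hJ hy),
          hI.mul_eq_zero _ (hJ hy) _ (hI.br_mem _ _)]
        simp
      · rw [hI.br_eq_zero _ (hJ hx) _ (hI.mul_mem _ _), hI.br_eq_zero _ (hJ hx) _ (hJ hz),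
          hI.br_eq_zero _ (hJ hx) _ (hJ hy)]
        simp

end Criterion

/-! ### The algebra given by the table -/

section TableAlgebra

variable {k X : Type*} [Field k] [LinearOrder X]

/-- The words that are not letters. -/
def longWords (X : Type*) : Set (MPWord X) := {W | ∀ a, W ≠ .lie (a, [])}

theorem lieMulWords_subset_longWords {X : Type*} (n : ℕ) : lieMulWords X n ⊆ longWords X := by
  rintro _ ⟨u, c, rfl, -⟩ a h
  cases h

theorem mulLetter_mem_longWords (W : MPWord X) (a : X) :
    mulLetter k W a ∈ Finsupp.supported k k (longWords X) := by
  match W with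
  | .lie (b, []) => exact Finsupp.single_mem_supported k _ (fun c h => by cases h)
  | .lie (a₁, a₂ :: l) =>
    exact Finsupp.supported_mono (lieMulWords_subset_longWords _) (mulLetter_lie_mem a)
  | .mon₂ a₁ a₂ =>
    simp only [mulLetter]
    split_ifs <;> exact Finsupp.single_mem_supported k _ (fun c h => by cases h)
  | .mon₃ _ _ _ => exact zero_mem _
  | .lieMul _ _ => exact zero_mem _

theorem brLetter_mem_longWords (W : MPWord X) (a : X) :
    brLetter k W a ∈ Finsupp.supported k k (longWords X) := by
  match W with
  | .lie u =>
    rw [brLetter_lie]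
    refine map_mem_of_supported (fun v hv => ?_) (lieBr_length_mem k u a)
    rw [lieIncl_single]
    refine Finsupp.single_mem_supported k _ fun c h => ?_
    cases h
    simp at hv
  | .mon₂ a₁ a₂ =>
    rw [brLetter_mon₂]
    exact Finsupp.supported_mono (lieMulWords_subset_longWords _)
      (add_mem (dotOp_mem (lieBr_mem_length (n := 0) (by simp) a) a₂)
        (dotOp_mem (lieBr_mem_length (n := 0) (by simp) a) a₁))
  | .mon₃ _ _ _ => exact zero_mem _
  | .lieMul (_, []) _ => exact zero_mem _
  | .lieMul (a₁, [a₂]) c =>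
    rw [brLetter_lieMul]
    exact map_mem_of_supported (S := Set.univ)
      (fun W _ => by rw [mulOp_single]; exact mulLetter_mem_longWords W c) (by simp)
  | .lieMul (a₁, a₂ :: a₃ :: l) c =>
    simp only [brLetter]
    split_ifs
    · exact Finsupp.single_mem_supported k _ (fun c h => by cases h)
    · exact sub_mem (Finsupp.single_mem_supported k _ (fun c h => by cases h))
        (Finsupp.single_mem_supported k _ (fun c h => by cases h))
    · exact zero_mem _

/-! ### The table on pairs of words -/

theorem tableMul_letter_right (W : MPWord X) (a : X) :
    tableMul k W (.lie (a, [])) = mulLetter k W a := by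
  unfold tableMul
  rfl

theorem tableBr_letter_right (W : MPWord X) (a : X) :
    tableBr k W (.lie (a, [])) = brLetter k W a := by
  unfold tableBr
  rfl

theorem tableMul_letter_left {W : MPWord X} (hW : W ∈ longWords X) (a : X) :
    tableMul k (.lie (a, [])) W = mulLetter k W a := by
  match W, hW with
  | .lie (b, []), hW => exact absurd rfl (hW b)
  | .lie (_, _ :: _), _ => rfl
  | .mon₂ _ _, _ => rfl
  | .mon₃ _ _ _, _ => rfl
  | .lieMul _ _, _ => rfl

theorem tableBr_letter_left {W : MPWord X} (hW : W ∈ longWords X) (a : X) :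
    tableBr k (.lie (a, [])) W = -brLetter k W a := by
  match W, hW with
  | .lie (b, []), hW => exact absurd rfl (hW b)
  | .lie (_, _ :: _), _ => rfl
  | .mon₂ _ _, _ => rfl
  | .mon₃ _ _ _, _ => rfl
  | .lieMul _ _, _ => rfl

theorem tableMul_longWords {W₁ W₂ : MPWord X} (h₁ : W₁ ∈ longWords X) (h₂ : W₂ ∈ longWords X) :
    tableMul k W₁ W₂ = 0 := by
  unfold tableMul
  split
  · exact absurd rfl (h₂ _)
  · exact absurd rfl (h₁ _)
  · rfl

theorem tableBr_longWords {W₁ W₂ : MPWord X} (h₁ : W₁ ∈ longWords X) (h₂ : W₂ ∈ longWords X) :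
    tableBr k W₁ W₂ = 0 := by
  unfold tableBr
  split
  · exact absurd rfl (h₂ _)
  · exact absurd rfl (h₁ _)
  · rfl

theorem letter_or_long {X : Type*} (W : MPWord X) : (∃ a, W = .lie (a, [])) ∨ W ∈ longWords X := by
  by_cases h : ∃ a, W = .lie (a, [])
  · exact Or.inl h
  · exact Or.inr fun a ha => h ⟨a, ha⟩

theorem tableMul_comm (W₁ W₂ : MPWord X) : tableMul k W₁ W₂ = tableMul k W₂ W₁ := by
  rcases letter_or_long W₁ with ⟨a, rfl⟩ | h₁ <;> rcases letter_or_long W₂ with ⟨b, rfl⟩ | h₂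
  · rw [tableMul_letter_right, tableMul_letter_right, mulLetter_letter_comm]
  · rw [tableMul_letter_right, tableMul_letter_left h₂]
  · rw [tableMul_letter_right, tableMul_letter_left h₁]
  · rw [tableMul_longWords h₁ h₂, tableMul_longWords h₂ h₁]

theorem tableBr_skew (W₁ W₂ : MPWord X) : tableBr k W₁ W₂ = -tableBr k W₂ W₁ := by
  rcases letter_or_long W₁ with ⟨a, rfl⟩ | h₁ <;> rcases letter_or_long W₂ with ⟨b, rfl⟩ | h₂
  · rw [tableBr_letter_right, tableBr_letter_right, brLetter_lie, brLetter_lie,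
      lieBr_letter_skew, map_neg]
  · rw [tableBr_letter_right, tableBr_letter_left h₂]
  · rw [tableBr_letter_right, tableBr_letter_left h₁, neg_neg]
  · rw [tableBr_longWords h₁ h₂, tableBr_longWords h₂ h₁, neg_zero]

theorem tableBr_self (W : MPWord X) : tableBr k W W = 0 := by
  rcases letter_or_long W with ⟨a, rfl⟩ | h
  · rw [tableBr_letter_right, brLetter_lie, lieBr_letter_self, map_zero]
  · exact tableBr_longWords h h

theorem tableMul_mem_longWords (W₁ W₂ : MPWord X) :
    tableMul k W₁ W₂ ∈ Finsupp.supported k k (longWords X) := by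
  unfold tableMul
  split
  · exact mulLetter_mem_longWords _ _
  · exact mulLetter_mem_longWords _ _
  · exact zero_mem _

theorem tableBr_mem_longWords (W₁ W₂ : MPWord X) :
    tableBr k W₁ W₂ ∈ Finsupp.supported k k (longWords X) := by
  unfold tableBr
  split
  · exact brLetter_mem_longWords _ _
  · exact neg_mem (brLetter_mem_longWords _ _)
  · exact zero_mem _

/-! ### From words to the vector space with basis `MPB k X` -/

namespace KMPB

variable (k X)

/-- The inclusion of `KMPB k X` into the space of linear combinations of all words. -/
def incl : KMPB k X →ₗ[k] (MPWord X →₀ k) :=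
  (Finsupp.supported k k (MPB k X)).subtype ∘ₗ
    (Finsupp.supportedEquivFinsupp (M := k) (R := k) (MPB k X)).symm.toLinearMap

/-- The element of `KMPB k X` given by a letter. -/
def letter (a : X) : KMPB k X :=
  Finsupp.single ⟨.lie (a, []), Y₁_subset_MPB k (mem_Y₁.2 (by simp))⟩ 1

/-- Identities may therefore be checked among combinations of all words, where `mulOp` and `brOp`
act without proofs of membership in the basis. -/
theorem incl_injective : Function.Injective (incl k X) :=
  Subtype.val_injective.comp (LinearEquiv.injective _)

variable {k X}

theorem incl_single (W : MPB k X) : incl k X (Finsupp.single W 1) = Finsupp.single W.1 1 := by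
  simp [incl]

theorem incl_letter (a : X) : incl k X (letter k X a) = Finsupp.single (.lie (a, [])) 1 :=
  incl_single _

theorem incl_apply (x : KMPB k X) (W : MPB k X) : incl k X x W.1 = x W := by
  obtain ⟨y, rfl⟩ := (Finsupp.supportedEquivFinsupp (M := k) (R := k) (MPB k X)).surjective x
  simp [incl]

theorem incl_mul_single (W₁ W₂ : MPB k X) :
    incl k X (mul k X (Finsupp.single W₁ 1) (Finsupp.single W₂ 1)) = tableMul k W₁.1 W₂.1 := by
  simp [incl, mul]

theorem incl_br_single (W₁ W₂ : MPB k X) :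
    incl k X (br k X (Finsupp.single W₁ 1) (Finsupp.single W₂ 1)) = tableBr k W₁.1 W₂.1 := by
  simp [incl, br]

theorem incl_mul_letter (x : KMPB k X) (a : X) :
    incl k X (mul k X x (letter k X a)) = mulOp a (incl k X x) := by
  refine LinearMap.congr_fun (f := incl k X ∘ₗ (mul k X).flip (letter k X a))
    (g := mulOp a ∘ₗ incl k X) ?_ x
  ext W : 2
  simp only [LinearMap.comp_apply, Finsupp.lsingle_apply, LinearMap.flip_apply]
  rw [letter, incl_mul_single, incl_single, mulOp_single, tableMul_letter_right]

theorem incl_br_letter (x : KMPB k X) (a : X) :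
    incl k X (br k X x (letter k X a)) = brOp a (incl k X x) := by
  refine LinearMap.congr_fun (f := incl k X ∘ₗ (br k X).flip (letter k X a))
    (g := brOp a ∘ₗ incl k X) ?_ x
  ext W : 2
  simp only [LinearMap.comp_apply, Finsupp.lsingle_apply, LinearMap.flip_apply]
  rw [letter, incl_br_single, incl_single, brOp_single, tableBr_letter_right]

variable (k X)

theorem mul_comm (x y : KMPB k X) : mul k X x y = mul k X y x := by
  refine LinearMap.congr_fun₂ (f := mul k X) (g := (mul k X).flip) ?_ x y
  ext W₁ W₂ : 4
  refine incl_injective k X ?_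
  simp only [LinearMap.comp_apply, Finsupp.lsingle_apply, LinearMap.flip_apply, incl_mul_single]
  exact tableMul_comm _ _

theorem br_skew (x y : KMPB k X) : br k X x y = -br k X y x := by
  rw [← neg_one_smul k]
  refine LinearMap.congr_fun₂ (f := br k X) (g := (-1 : k) • (br k X).flip) ?_ x y
  ext W₁ W₂ : 4
  refine incl_injective k X ?_
  simp only [LinearMap.comp_apply, Finsupp.lsingle_apply, LinearMap.flip_apply, incl_br_single,
    LinearMap.smul_apply, neg_one_smul, map_neg]
  exact tableBr_skew W₁.1 W₂.1

/-- Skew-symmetry alone is too weak in characteristic two. The squares of basis words are zero in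
the table, and skew-symmetry cancels the cross terms of a sum. -/
theorem br_self (x : KMPB k X) : br k X x x = 0 := by
  induction x using Finsupp.induction_linear with
  | zero => simp
  | add x y hx hy => simp [hx, hy, br_skew k X x y]
  | single W c =>
    have h : br k X (Finsupp.single W 1) (Finsupp.single W 1) = 0 := by
      refine incl_injective k X ?_
      rw [incl_br_single, tableBr_self, map_zero]
    rw [← mul_one c, ← smul_eq_mul, ← Finsupp.smul_single, map_smul, map_smul,
      LinearMap.smul_apply, h, smul_zero, smul_zero]

/-- The words that are not letters, as elements of `KMPB k X`. -/
def longBasis : Set (KMPB k X) :=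
  (fun W : MPB k X => Finsupp.single W (1 : k)) '' {W | W.1 ∈ longWords X}

theorem span_letters_long :
    Submodule.span k (Set.range (letter k X) ∪ longBasis k X) = ⊤ := by
  rw [Submodule.eq_top_iff']
  intro x
  induction x using Finsupp.induction_linear with
  | zero => exact zero_mem _
  | add x y hx hy => exact add_mem hx hy
  | single W c =>
    rw [← mul_one c, ← smul_eq_mul, ← Finsupp.smul_single]
    refine Submodule.smul_mem _ _ (Submodule.subset_span ?_)
    obtain ⟨W, hW⟩ := W
    rcases letter_or_long W with ⟨a, rfl⟩ | h
    · exact Or.inl ⟨a, rfl⟩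
    · exact Or.inr ⟨⟨W, hW⟩, h, rfl⟩

variable {k X}

theorem mem_span_longBasis {x : KMPB k X}
    (hx : incl k X x ∈ Finsupp.supported k k (longWords X)) :
    x ∈ Submodule.span k (longBasis k X) := by
  rw [longBasis, ← Finsupp.supported_eq_span_single, Finsupp.mem_supported]
  intro W hW
  refine (Finsupp.mem_supported k _).1 hx ?_
  simp only [Finset.mem_coe, Finsupp.mem_support_iff, incl_apply] at hW ⊢
  exact hW

variable (k X)

/-- The words that are not letters annihilate one another by rule 1, and no letter ever occurs in a
value of the table. -/
theorem isMetabelianIdeal :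
    IsMetabelianIdeal (mul k X) (br k X) (Submodule.span k (longBasis k X)) := by
  have hz : ∀ g : KMPB k X →ₗ[k] KMPB k X →ₗ[k] KMPB k X,
      (∀ x ∈ longBasis k X, ∀ y ∈ longBasis k X, g x y = 0) →
      ∀ x ∈ Submodule.span k (longBasis k X), ∀ y ∈ Submodule.span k (longBasis k X),
        g x y = 0 := by
    intro g h x hx y hy
    induction hx, hy using Submodule.span_induction₂ with
    | mem_mem x y hx hy => exact h x hx y hy
    | zero_left => simp
    | zero_right => simp
    | add_left x y z _ _ _ h₁ h₂ => simp [h₁, h₂]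
    | add_right x y z _ _ _ h₁ h₂ => simp [h₁, h₂]
    | smul_left c x y _ _ h => simp [h]
    | smul_right c x y _ _ h => simp [h]
  have hm : ∀ g : KMPB k X →ₗ[k] KMPB k X →ₗ[k] KMPB k X,
      (∀ W₁ W₂ : MPB k X, incl k X (g (Finsupp.single W₁ 1) (Finsupp.single W₂ 1)) ∈
        Finsupp.supported k k (longWords X)) → ∀ x y, g x y ∈ Submodule.span k (longBasis k X) := by
    intro g h x y
    refine mem_span_longBasis ?_
    refine map_mem_of_supported (S := Set.univ) (F := incl k X ∘ₗ g x) (fun W₂ _ => ?_) (by simp)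
    exact map_mem_of_supported (S := Set.univ)
      (F := incl k X ∘ₗ g.flip (Finsupp.single W₂ 1)) (fun W₁ _ => h W₁ W₂) (by simp)
  refine ⟨hz _ ?_, hz _ ?_, hm _ fun W₁ W₂ => ?_, hm _ fun W₁ W₂ => ?_⟩
  · rintro _ ⟨W₁, h₁, rfl⟩ _ ⟨W₂, h₂, rfl⟩
    refine incl_injective k X ?_
    rw [incl_mul_single, tableMul_longWords h₁ h₂, map_zero]
  · rintro _ ⟨W₁, h₁, rfl⟩ _ ⟨W₂, h₂, rfl⟩
    refine incl_injective k X ?_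
    rw [incl_br_single, tableBr_longWords h₁ h₂, map_zero]
  · rw [incl_mul_single]
    exact tableMul_mem_longWords _ _
  · rw [incl_br_single]
    exact tableBr_mem_longWords _ _

theorem isPoissonAlgebra : IsPoissonAlgebra (mul k X) (br k X) := by
  have inj := incl_injective k X
  refine isPoissonAlgebra_of_letters (letter k X) (longBasis k X) (span_letters_long k X)
    (mul_comm k X) (br_self k X) (isMetabelianIdeal k X) ?_ ?_ ?_ ?_ ?_ ?_ ?_
  · intro a b c
    refine inj ?_
    simp only [incl_mul_letter, incl_letter, mulOp_single]
    exact mulOp_letters_cycle a b c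
  · rintro _ ⟨W, hW, rfl⟩ a b
    refine inj ?_
    simp only [incl_mul_letter, incl_single, mulOp_single, map_zero]
    exact mulOp_mulOp_eq_zero ⟨W.2, hW⟩ a b
  · intro a b c
    refine inj ?_
    simp only [incl_br_letter, incl_letter, brOp_single, map_zero, map_add]
    exact brOp_letters_jacobi a b c
  · rintro _ ⟨W, hW, rfl⟩ a b
    refine inj ?_
    simp only [incl_br_letter, incl_single, brOp_single]
    exact brOp_brLetter_comm ⟨W.2, hW⟩ a b
  · intro a b c
    refine inj ?_
    simp only [incl_br_letter, incl_mul_letter, incl_letter, brOp_single, mulOp_single, map_add]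
    exact brOp_mulLetter_letter a b c
  · rintro _ ⟨W, hW, rfl⟩ a c
    refine inj ?_
    simp only [incl_br_letter, incl_mul_letter, incl_single, brOp_single, mulOp_single]
    exact brOp_mulLetter_comm ⟨W.2, hW⟩ a c
  · rintro _ ⟨W, hW, rfl⟩ b c
    refine inj ?_
    simp only [incl_br_letter, incl_mul_letter, incl_single, brOp_single, map_add, map_zero]
    exact mulOp_brLetter_skew ⟨W.2, hW⟩ b c

/-! ### The value of a word in `KMPB k X` -/

variable {k X}

/-- Induction on the last letter: it is at least as large as all earlier ones in the tail, so rule 4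
appends it with no straightening. -/
theorem incl_leftNormed {a : X} {l : List X} (h : MPWord.lie (a, l) ∈ Y₁ X) :
    incl k X (leftNormed (br k X) (letter k X a) (l.map (letter k X))) =
      Finsupp.single (.lie (a, l)) 1 := by
  induction l using List.reverseRecOn with
  | nil => exact incl_letter a
  | append_singleton l b ih =>
    obtain ⟨h₁, h₂⟩ := mem_Y₁.1 h
    have hl := (List.pairwise_append.1 h₁)
    rw [List.map_append, leftNormed_append, List.map_singleton, leftNormed_cons, leftNormed_nil,
      incl_br_letter, ih, brOp_single, brLetter_lie]
    · obtain _ | ⟨a₂, l⟩ := l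
      · have : b < a := by simpa using h₂
        simp [lieBr, this]
      · have hb : a₂ ≤ b := hl.2.2 a₂ (by simp) b (by simp)
        have e : reorder (b :: l) = l ++ [b] := by
          rw [reorder_congr (List.perm_append_singleton b l).symm, reorder_eq_self]
          exact (List.pairwise_cons.1 h₁).2
        simp [lieBr, hb, e]
    · refine mem_Y₁.2 ⟨hl.1, fun a₂ ha₂ => h₂ a₂ ?_⟩
      obtain _ | ⟨a₂, l⟩ := l
      · simp at ha₂
      · simpa using ha₂

/-- The table does not alter an expression already in normal form. This is the source of linear
independence: words with independent values in one metabelian Poisson algebra are independent in the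
free one. -/
theorem eval_word (W : MPB k X) :
    W.1.eval (mul k X) (br k X) (letter k X) = Finsupp.single W 1 := by
  refine incl_injective k X ?_
  rw [incl_single]
  obtain ⟨W, hW⟩ := W
  rcases hW with ((⟨a, l, rfl, h₁, h₂⟩ | ⟨a, b, rfl, h⟩ | ⟨a, b, c, rfl, h, h'⟩) |
    ⟨a, b, c, rfl, h⟩) | hW
  · exact incl_leftNormed (mem_Y₁.2 ⟨h₁, h₂⟩)
  · simp [MPWord.eval, incl_mul_letter, incl_letter, mulLetter, h]
  -- The table tests `c ≤ a` and `c ≤ b` first. In a sorted monomial these hold only when the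
  -- letters coincide, and then the outcome is the same word.
  · have : c ≤ a → c = a ∧ b = a := fun hc =>
      ⟨le_antisymm hc (h.trans h'), le_antisymm (h'.trans hc) h⟩
    have : c ≤ b → c = b := fun hc => le_antisymm hc h'
    simp only [MPWord.eval, incl_mul_letter, incl_letter, mulOp_single, mulLetter, h, min_eq_left,
      max_eq_right]
    grind
  · rw [MPWord.eval, incl_mul_letter, incl_leftNormed (mem_Y₁_cons.2 (by simp [h])), mulOp_single]
    rfl
  · split_ifs at hW with hk
    · obtain ⟨a₁, a₂, l, c, rfl, hl, h₁, h₂⟩ := hW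
      obtain ⟨a₃, l, rfl⟩ := List.exists_cons_of_ne_nil hl
      obtain ⟨h₃, h₄⟩ := List.pairwise_cons.1 h₂
      have e : reorder (c :: a₃ :: l) = (a₃ :: l) ++ [c] := by
        rw [reorder_congr (List.perm_append_singleton c (a₃ :: l)).symm]
        exact reorder_eq_self h₄
      rw [MPWord.eval, incl_mul_letter, incl_leftNormed, mulOp_single]
      · simp only [mulLetter, hk, if_true]
        rw [if_pos (h₃ c (by simp)), arrowDot, e, List.dropLast_concat, getLastD_concat]
      · exact mem_Y₁_cons.2 ⟨h₁, fun b hb => h₃ b (List.mem_append_left _ hb),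
          (List.pairwise_append.1 h₄).1⟩
    · obtain ⟨a₁, a₂, a₃, c, rfl, h₁, h₂, h₃, h₄⟩ := hW
      rw [MPWord.eval, incl_mul_letter, incl_leftNormed (mem_Y₁_cons.2 (by simp [h₁, h₃])),
        mulOp_single]
      simp [mulLetter, hk, h₄, h₄.ne, h₂]

end KMPB

/-! ### The homomorphism from `KMPB k X` given by the values of words -/

section EvalHom

variable {A : Type*} [AddCommGroup A] [Module k A] {mul br : A →ₗ[k] A →ₗ[k] A}
  {I : Submodule k A}

theorem ne_lieMul_letter {W : MPWord X} (hW : W ∈ MPB k X) (b c : X) : W ≠ .lieMul (b, []) c := by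
  rintro rfl
  rcases MPB_cases k hW with ⟨a, h⟩ | ⟨u, h, hu⟩ | ⟨a, b, h⟩ | ⟨a, b, c, h⟩ | ⟨a, b, c, h, -⟩ |
    ⟨-, u, c, h, hu⟩ | ⟨-, ⟨u, c, h, hu⟩, -⟩ <;> cases h <;> simp at hu

theorem eval_mem {X : Type*} (hI : IsMetabelianIdeal mul br I) (f : X → A) {W : MPWord X}
    (hW : W ∈ longWords X) : W.eval mul br f ∈ I := by
  match W, hW with
  | .lie (b, []), hW => exact absurd rfl (hW b)
  | .lie (_, _ :: _), _ => exact leftNormed_mem hI (hI.br_mem _ _) _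
  | .mon₂ _ _, _ => exact hI.mul_mem _ _
  | .mon₃ _ _ _, _ => exact hI.mul_mem _ _
  | .lieMul _ _, _ => exact hI.mul_mem _ _

/-- Two words that are not letters have values in `I`, so both sides vanish; if one factor is a
letter, commutativity reduces to `evalLin_mulLetter`. -/
theorem evalLin_tableMul (hP : IsPoissonAlgebra mul br) (hI : IsMetabelianIdeal mul br I)
    (f : X → A) {W₁ W₂ : MPWord X} (h₁ : W₁ ∈ MPB k X) (h₂ : W₂ ∈ MPB k X) :
    evalLin mul br f (tableMul k W₁ W₂) = mul (W₁.eval mul br f) (W₂.eval mul br f) := by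
  have right : ∀ W ∈ MPB k X, ∀ a, evalLin mul br f (tableMul k W (.lie (a, []))) =
      mul (W.eval mul br f) (f a) := fun W hW a => by
    rw [tableMul_letter_right, evalLin_mulLetter f hP hI W (ne_lieMul_letter hW)]
  rcases letter_or_long W₂ with ⟨a, rfl⟩ | l₂
  · exact right W₁ h₁ a
  · rcases letter_or_long W₁ with ⟨a, rfl⟩ | l₁
    · rw [tableMul_comm, right W₂ h₂, hP.mul_comm]
      rfl
    · rw [tableMul_longWords l₁ l₂, map_zero,
        hI.mul_eq_zero _ (eval_mem hI f l₁) _ (eval_mem hI f l₂)]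

theorem evalLin_tableBr (hP : IsPoissonAlgebra mul br) (hI : IsMetabelianIdeal mul br I)
    (f : X → A) {W₁ W₂ : MPWord X} (h₁ : W₁ ∈ MPB k X) (h₂ : W₂ ∈ MPB k X) :
    evalLin mul br f (tableBr k W₁ W₂) = br (W₁.eval mul br f) (W₂.eval mul br f) := by
  have right : ∀ W ∈ MPB k X, ∀ a, evalLin mul br f (tableBr k W (.lie (a, []))) =
      br (W.eval mul br f) (f a) := fun W hW a => by
    rw [tableBr_letter_right, evalLin_brLetter f hP hI W (ne_lieMul_letter hW)]
  rcases letter_or_long W₂ with ⟨a, rfl⟩ | l₂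
  · exact right W₁ h₁ a
  · rcases letter_or_long W₁ with ⟨a, rfl⟩ | l₁
    · rw [tableBr_skew, map_neg, right W₂ h₂, hP.br_skew (MPWord.eval _ _ _ _), neg_neg]
      rfl
    · rw [tableBr_longWords l₁ l₂, map_zero,
        hI.br_eq_zero _ (eval_mem hI f l₁) _ (eval_mem hI f l₂)]

/-- The linear map on `KMPB k X` that sends each word to its value. -/
def KMPB.evalHom (mul br : A →ₗ[k] A →ₗ[k] A) (f : X → A) : KMPB k X →ₗ[k] A :=
  evalLin mul br f ∘ₗ KMPB.incl k X

theorem KMPB.evalHom_single (f : X → A) (W : MPB k X) :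
    KMPB.evalHom mul br f (Finsupp.single W 1) = W.1.eval mul br f := by
  simp [KMPB.evalHom, KMPB.incl_single]

theorem KMPB.evalHom_mul (hP : IsPoissonAlgebra mul br) (hI : IsMetabelianIdeal mul br I)
    (f : X → A) (x y : KMPB k X) : KMPB.evalHom mul br f (KMPB.mul k X x y) =
      mul (KMPB.evalHom mul br f x) (KMPB.evalHom mul br f y) := by
  refine LinearMap.congr_fun₂ (f := (KMPB.mul k X).compr₂ (KMPB.evalHom mul br f))
    (g := mul.compl₁₂ (KMPB.evalHom mul br f) (KMPB.evalHom mul br f)) ?_ x y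
  ext W₁ W₂ : 4
  simp only [LinearMap.comp_apply, Finsupp.lsingle_apply, LinearMap.compr₂_apply,
    LinearMap.compl₁₂_apply, KMPB.evalHom_single]
  rw [KMPB.evalHom, LinearMap.comp_apply, KMPB.incl_mul_single,
    evalLin_tableMul hP hI f W₁.2 W₂.2]

theorem KMPB.evalHom_br (hP : IsPoissonAlgebra mul br) (hI : IsMetabelianIdeal mul br I)
    (f : X → A) (x y : KMPB k X) : KMPB.evalHom mul br f (KMPB.br k X x y) =
      br (KMPB.evalHom mul br f x) (KMPB.evalHom mul br f y) := by
  refine LinearMap.congr_fun₂ (f := (KMPB.br k X).compr₂ (KMPB.evalHom mul br f))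
    (g := br.compl₁₂ (KMPB.evalHom mul br f) (KMPB.evalHom mul br f)) ?_ x y
  ext W₁ W₂ : 4
  simp only [LinearMap.comp_apply, Finsupp.lsingle_apply, LinearMap.compr₂_apply,
    LinearMap.compl₁₂_apply, KMPB.evalHom_single]
  rw [KMPB.evalHom, LinearMap.comp_apply, KMPB.incl_br_single,
    evalLin_tableBr hP hI f W₁.2 W₂.2]

/-- Homomorphisms of algebras with two operations preserve the values of words. -/
theorem MPWord.map_eval {X A B : Type*} [AddCommGroup A] [Module k A] [AddCommGroup B] [Module k B]
    {mul br : A →ₗ[k] A →ₗ[k] A} {mul' br' : B →ₗ[k] B →ₗ[k] B} (φ : A →ₗ[k] B)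
    (hmul : ∀ x y, φ (mul x y) = mul' (φ x) (φ y)) (hbr : ∀ x y, φ (br x y) = br' (φ x) (φ y))
    (f : X → A) (W : MPWord X) :
    φ (W.eval mul br f) = W.eval mul' br' (fun a => φ (f a)) := by
  have hl : ∀ (l : List X) (x : A),
      φ (leftNormed br x (l.map f)) = leftNormed br' (φ x) (l.map fun a => φ (f a)) := by
    intro l
    induction l with
    | nil => exact fun x => rfl
    | cons a l ih =>
      intro x
      simp only [List.map_cons, leftNormed_cons, ih, hbr]
  cases W <;> simp [MPWord.eval, hl, hmul]

end EvalHom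

end TableAlgebra
end

/-! ### The isomorphism with the free algebra -/

theorem theorem2p8 (k X : Type*) [Field k] [LinearOrder X] [WellFoundedLT X] :
    -- the multiplication table defines a metabelian Poisson algebra
    IsPoissonAlgebra (KMPB.mul k X) (KMPB.br k X) ∧
    IsMetabelian (KMPB.mul k X) (KMPB.br k X) ∧
    -- which is isomorphic to the free one, by an isomorphism that is the identity on words
    (∃ φ : MP k X ≃ₗ[k] KMPB k X,
      (∀ x y, φ (MP.mul k X x y) = KMPB.mul k X (φ x) (φ y)) ∧
      (∀ x y, φ (MP.br k X x y) = KMPB.br k X (φ x) (φ y)) ∧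
      (∀ W : MPB k X, φ (W.1.eval (MP.mul k X) (MP.br k X) (MP.of k X)) =
        Finsupp.single W 1)) ∧
    -- and the words of `MPB_k(X)` form a linear basis of the free algebra
    (∃ b : Module.Basis (MPB k X) k (MP k X),
      ∀ W : MPB k X, b W = W.1.eval (MP.mul k X) (MP.br k X) (MP.of k X)) := by
  have hP := KMPB.isPoissonAlgebra k X
  have hM := (KMPB.isMetabelianIdeal k X).isMetabelian
  have hQ := MP.isPoissonAlgebra k X
  obtain ⟨I, hI⟩ := (MP.isMetabelian k X).exists_ideal
  obtain ⟨φ, ⟨φmul, φbr, φof⟩, -⟩ := MP.existsUnique_lift k X _ _ hP hM (KMPB.letter k X)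
  let ψ : KMPB k X →ₗ[k] MP k X := KMPB.evalHom (MP.mul k X) (MP.br k X) (MP.of k X)
  have φword : ∀ W : MPB k X,
      φ (W.1.eval (MP.mul k X) (MP.br k X) (MP.of k X)) = Finsupp.single W 1 := fun W => by
    rw [MPWord.map_eval φ φmul φbr, ← KMPB.eval_word W]
    simp only [φof]
  have hφψ : φ ∘ₗ ψ = LinearMap.id := by
    ext W : 2
    simp only [LinearMap.comp_apply, Finsupp.lsingle_apply, LinearMap.id_apply, ψ,
      KMPB.evalHom_single, φword]
  -- Both this composite and the identity extend the inclusion of the generators, so uniqueness in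
  -- the universal property identifies them. This shows that the words span, without a separate
  -- rewriting argument.
  have hψφ : ψ ∘ₗ φ = LinearMap.id := by
    refine (MP.existsUnique_lift k X _ _ hQ (MP.isMetabelian k X) (MP.of k X)).unique
      ⟨fun x y => ?_, fun x y => ?_, fun a => ?_⟩ ⟨fun _ _ => rfl, fun _ _ => rfl, fun _ => rfl⟩
    · simp only [LinearMap.comp_apply, φmul, ψ, KMPB.evalHom_mul hQ hI]
    · simp only [LinearMap.comp_apply, φbr, ψ, KMPB.evalHom_br hQ hI]
    · rw [LinearMap.comp_apply, φof]
      exact KMPB.evalHom_single _ _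
  let e : MP k X ≃ₗ[k] KMPB k X := LinearEquiv.ofLinearMap φ ψ hφψ hψφ
  refine ⟨hP, hM, ⟨e, φmul, φbr, φword⟩, Module.Basis.ofRepr e, fun W => ?_⟩
  rw [Module.Basis.coe_ofRepr]
  exact KMPB.evalHom_single _ W
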